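/- **Setting.** Fix $D\ge 1$ and attach $\mathbb{C}^D$ to every site of $\mathbb{Z}$. For finite $\Lambda\subset\mathbb{Z}$ let $\mathcal{A}_\Lambda$ be the algebra of linear operators on $\bigotimes_{x\in\Lambda}\mathbb{C}^D$ with the operator norm; for $X\subset\Lambda$, $A\in\mathcal{A}_X$ is identified with $A\otimes\mathbf{1}_{\Lambda\setminus X}\in\mathcal{A}_\Lambda$. An *interaction* $\Psi$ on $\mathbb{Z}$ assigns to every finite $X\subset\mathbb{Z}$ a self-adjoint $\Psi(X)\in\mathcal{A}_X$; its local Hamiltonians are $H_\Lambda=\sum_{X\subset\Lambda}\Psi(X)$, and for $b>0$ $$\|\Psi\|_b=\sup_{z\in\mathbb{Z}}\ \sum_{Z\ni z}|Z|\,\|\Psi(Z)\|\,e^{b\,\mathrm{diam}(Z)}\in[0,\infty].$$ For self-adjoint $H\in\mathcal{A}_\Lambda$ and $\beta>0$ let $\rho_\beta^\Lambda[H]=e^{-\beta H}/\mathrm{Tr}\,e^{-\beta H}$. For a state $\rho$ on $\mathcal{A}_\Lambda$ and $X,Y\subset\Lambda$ let $\mathrm{Cov}_\rho(X;Y)$ be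 the supremum of $|\mathrm{Tr}(\rho AB)-\mathrm{Tr}(\rho A)\,\mathrm{Tr}(\rho B)|$ over $A\in\mathcal{A}_X$, $B\in\mathcal{A}_Y$ with $\|A\|=\|B\|=1$. Let $d(X,Y)$ be the distance of $X$ and $Y$ ($d(X,Y)=\infty$ and $e^{-c\,d(X,Y)}=0$ if one of them is empty). Intervals may be empty, and $Y<X$ means $y<x$ for all $y\in Y$, $x\in X$. **Theorem.** For all $b,C_{\mathrm{int}},\beta,C_{\mathrm{Cov}},c_{\mathrm{Cov}}>0$ there exist constants $C,c>0$, depending only on these five numbers, such that the following holds. Let $\Psi$ be an interaction on $\mathbb{Z}$ with $\|\Psi\|_b\le C_{\mathrm{int}}$, let $I\subset\mathbb{Z}$ be a finite interval, and assume that $\rho=\rho_\beta^I[H_I]$ satisfies $$\mathrm{Cov}_{\rho}(X;Y)\le C_{\mathrm{Cov}}\,e^{-c_{\mathrm{Cov}}\,d(X,Y)}\qquad\text{for all subintervals }X,Y\subset I.$$ Then for all subintervals $X,Y_1,Y_2\subset I$ with $Y_1<X<Y_2$ and $Y_1<Y_2$, with $Y=Y_1\cup Y_2$, all self-adjoint $V\in\mathcal{A}_X$,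 and all $B=B_1\otimes B_2$ with $B_1\in\mathcal{A}_{Y_1}$, $B_2\in\mathcal{A}_{Y_2}$, $$\bigl|\mathrm{Tr}\bigl(\rho_\beta^I[H_I]\,B\bigr)-\mathrm{Tr}\bigl(\rho_\beta^I[H_I+V]\,B\bigr)\bigr|\le C\,\|B\|\,e^{3\beta\|V\|}\,(1+\|V\|)\,e^{-c\,d(X,Y)}.$$ If, moreover, $\|\Psi+V\|_b\le C_{\mathrm{int}}$, then the bound holds without the factor $1+\|V\|$. Here $V$ is regarded as an interaction: it suffices that $V=\sum_{Z\subset I}\Phi(Z)$ for some interaction $\Phi$ with $\|\Psi+\Phi\|_b\le C_{\mathrm{int}}$ (for example $\Phi(X)=V$ and $\Phi(Z)=0$ for $Z\ne X$). -/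

import Mathlib

open scoped Matrix.Norms.L2Operator

namespace SpinChain

/-- The algebra of observables `𝓑(⨂_{x ∈ X} ℂ^D)` of a finite set `X` of sites of the chain `ℤ`,
as matrices in the product orthonormal basis, which is indexed by the configurations
`X → Fin D`. It carries the operator norm (of matrices acting on the Euclidean space). -/
abbrev LocalAlgebra (D : ℕ) (X : Finset ℤ) : Type :=
  Matrix (X → Fin D) (X → Fin D) ℂ

/-- The identification of `A ∈ 𝓐_X` with `A ⊗ 1_{Λ ∖ X} ∈ 𝓐_Λ`, for `X ⊆ Λ`. -/
def embed {D : ℕ} {X Λ : Finset ℤ} (h : X ⊆ Λ) (A : LocalAlgebra D X) : LocalAlgebra D Λ :=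
  Matrix.of fun σ τ =>
    if ∀ x : Λ, (x : ℤ) ∉ X → σ x = τ x then
      A (fun x => σ ⟨x, h x.2⟩) (fun x => τ ⟨x, h x.2⟩)
    else 0

/-- An interaction on `ℤ`: a self-adjoint element of `𝓐_X` for every finite `X ⊆ ℤ`. -/
@[ext]
structure Interaction (D : ℕ) where
  term : (X : Finset ℤ) → LocalAlgebra D X
  selfAdjoint : ∀ X : Finset ℤ, (term X).IsHermitian

/-- The sum of two interactions. -/
instance {D : ℕ} : Add (Interaction D) where
  add Ψ Φ := ⟨fun X => Ψ.term X + Φ.term X,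
    fun X => (Ψ.selfAdjoint X).add (Φ.selfAdjoint X)⟩

/-- The interaction norm
`‖Ψ‖_b = sup_z ∑_{Z ∋ z} |Z| ‖Ψ(Z)‖ / exp (-b diam Z)`, with value `∞` allowed. -/
noncomputable def Interaction.eNorm {D : ℕ} (b : ℝ) (Ψ : Interaction D) : ENNReal :=
  ⨆ z : ℤ, ∑' Z : {Z : Finset ℤ // z ∈ Z},
    ENNReal.ofReal
      ((Z.1.card : ℝ) * ‖Ψ.term Z.1‖ / Real.exp (-b * Metric.diam (Z.1 : Set ℤ)))

/-- The local Hamiltonian `H_Λ = ∑_{X ⊆ Λ} Ψ(X) ∈ 𝓐_Λ`. -/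
def Interaction.hamiltonian {D : ℕ} (Ψ : Interaction D) (Λ : Finset ℤ) : LocalAlgebra D Λ :=
  ∑ X ∈ Λ.powerset.attach, embed (Finset.mem_powerset.1 X.2) (Ψ.term X.1)

/-- The Gibbs state `ρ_β[H] = e^{-βH} / Tr e^{-βH}`, as a density matrix. -/
noncomputable def gibbs {D : ℕ} {Λ : Finset ℤ} (β : ℝ) (H : LocalAlgebra D Λ) :
    LocalAlgebra D Λ :=
  (NormedSpace.exp (-(β : ℂ) • H)).trace⁻¹ • NormedSpace.exp (-(β : ℂ) • H)

/-- `Cov_ρ(A, B) = Tr(ρAB) - Tr(ρA) Tr(ρB)`. -/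
def cov {D : ℕ} {Λ : Finset ℤ} (ρ A B : LocalAlgebra D Λ) : ℂ :=
  (ρ * A * B).trace - (ρ * A).trace * (ρ * B).trace

/-- `Cov_ρ(X; Y)`, the supremum of `|Cov_ρ(A, B)|` over `A ∈ 𝓐_X` and `B ∈ 𝓐_Y` of norm one. -/
noncomputable def eCov {D : ℕ} {Λ X Y : Finset ℤ} (ρ : LocalAlgebra D Λ)
    (hX : X ⊆ Λ) (hY : Y ⊆ Λ) : ENNReal :=
  ⨆ (A : LocalAlgebra D X) (_ : ‖A‖ = 1) (B : LocalAlgebra D Y) (_ : ‖B‖ = 1),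
    ENNReal.ofReal ‖cov ρ (embed hX A) (embed hY B)‖

/-- The distance of two finite subsets of `ℤ`; it is `⊤` if one of them is empty. -/
noncomputable def setDist (X Y : Finset ℤ) : ℕ∞ :=
  ⨅ x ∈ X, ⨅ y ∈ Y, ((x - y).natAbs : ℕ∞)

/-- `e^{-c d}`, with `e^{-c ∞} = 0`. -/
noncomputable def expDecay (c : ℝ) (d : ℕ∞) : ℝ :=
  if d = ⊤ then 0 else Real.exp (-c * (d.toNat : ℝ))

/-- A state `ρ` on `𝓐_I` satisfies exponential decay of correlations between intervals, with
constants `C` and `c`: `Cov_ρ(X; Y) ≤ C e^{-c d(X,Y)}` for all subintervals `X, Y ⊆ I`. -/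
def DecayOfCorrelations {D : ℕ} {I : Finset ℤ} (ρ : LocalAlgebra D I) (C c : ℝ) : Prop :=
  ∀ (X Y : Finset ℤ) (hX : X ⊆ I) (hY : Y ⊆ I),
    (X : Set ℤ).OrdConnected → (Y : Set ℤ).OrdConnected →
      eCov ρ hX hY ≤ ENNReal.ofReal (C * expDecay c (setDist X Y))

end SpinChain

/-! The proof is by quantum belief propagation with a Gaussian kernel. Take a kernel $p$ with $\hat
p(\omega)=e^{-\beta\omega/2-\beta^2\omega^2/8}$, so that $\hat p(0)=1$ and $e^{-\beta\omega}\hat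
p(-\omega)=\hat p(\omega)$. Then $\Phi_h=i\int p(s)\int_0^s e^{ith}Ve^{-ith}\,dt\,ds$ acts in the
eigenbasis of $h$ as the multiplier $(\hat p(\omega)-1)/\omega$, and the symmetry of $\hat p$ turns
Duhamel's formula for the derivative of $e^{-\beta h}$ in direction $V$ into $\Phi_h e^{-\beta
h}+e^{-\beta h}\Phi_h^*$ (`qbp_identity`). Solving $\xi'=\xi\,\Phi_{H+(1-s)V}$ gives
$e^{-\beta(H+V)}=\xi e^{-\beta H}\xi^*$ (`exp_hamiltonian_add_eq`). The generator is not required to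
be self-adjoint, only bounded by $\frac23\beta\|V\|$.

The operator $\xi$ is almost local around $X$. A Lieb–Robinson estimate on nested windows around $X$
controls the dependence of $e^{ith}Ve^{-ith}$ on remote terms, with an error $e^{v|t|}q^n$,
$q=e^{-b/2}$. The Gaussian integrates $e^{v|t|}$ for every $v$, so the rate $q^n$ survives. All
windows contain $X$, so $V$ cancels from the increments of the Hamiltonians and $v$ depends on
$\Psi$ alone. The generator error is proportional to $\|V\|$, and Gronwall divides by the generator
bound, itself proportional to $\|V\|$. Hence no factor $1+\|V\|$ appears, and one estimate proves
both parts of the theorem.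

Now replace $\xi$ by $\zeta$, the solution of the same equation inside the window of radius $d/2$,
which commutes with $B$ (`exists_local_intertwiner`). The change of the expectation of $B$ becomes a
covariance of $\zeta^*\zeta$ with $B_1B_2$, up to the error $\|\xi-\zeta\|$
(`norm_trace_sub_perturbed_le`). Since $Y$ is not an interval, that covariance is rewritten through
three covariances of intervals (`norm_cov_three_le`). They are bounded by $\|B_1\|\|B_2\|$, which
multiplicativity of the operator norm on disjoint supports compares with $\|B\|$.

The exponent 3 is the sum of 1 from the ratio of partition functions (`exp_neg_mul_trace_le`),
$\frac23$ from $\|\xi\|$ and $\|\zeta\|$, and $\frac43$ from $\|\xi-\zeta\|$. -/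

namespace SpinChain

/-! ### Linear differential equations in a Banach algebra -/

section Dyson

variable {A : Type*} [NormedRing A] [NormedAlgebra ℝ A]

/-- The terms of the Dyson series of `ξ' = ξ F`, `ξ 0 = 1`. -/
noncomputable def dysonTerm (F : ℝ → A) : ℕ → ℝ → A
  | 0 => fun _ => 1
  | n + 1 => fun s => ∫ u in (0 : ℝ)..s, dysonTerm F n u * F u

theorem continuous_dysonTerm {F : ℝ → A} (hF : Continuous F) (n : ℕ) :
    Continuous (dysonTerm F n) := by
  induction n with
  | zero => exact continuous_const
  | succ n ih =>
    exact intervalIntegral.continuous_primitive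
      (fun a b => (ih.mul hF).intervalIntegrable a b) 0

theorem hasDerivAt_dysonTerm_succ [CompleteSpace A] {F : ℝ → A} (hF : Continuous F) (n : ℕ) (s : ℝ) :
    HasDerivAt (dysonTerm F (n + 1)) (dysonTerm F n s * F s) s := by
  have hc := (continuous_dysonTerm hF n).mul hF
  exact intervalIntegral.integral_hasDerivAt_right (hc.intervalIntegrable _ _)
    (hc.stronglyMeasurableAtFilter _ _) hc.continuousAt

theorem norm_dysonTerm_le [NormOneClass A] {F : ℝ → A} (hF : Continuous F) {M : ℝ}
    (hM : ∀ s, ‖F s‖ ≤ M) (n : ℕ) (s : ℝ) :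
    ‖dysonTerm F n s‖ ≤ (M * |s|) ^ n / n.factorial := by
  have hM0 : 0 ≤ M := (norm_nonneg _).trans (hM 0)
  induction n generalizing s with
  | zero => simp [dysonTerm]
  | succ n ih =>
    refine (intervalIntegral.norm_integral_le_integral_norm_uIoc).trans ?_
    have hc := ((continuous_dysonTerm hF n).mul hF).norm
    have hc' : Continuous fun u : ℝ => (M ^ (n + 1) / n.factorial) * |u - 0| ^ n := by fun_prop
    calc ∫ u in Set.uIoc 0 s, ‖dysonTerm F n u * F u‖
        ≤ ∫ u in Set.uIoc 0 s, (M ^ (n + 1) / n.factorial) * |u - 0| ^ n := by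
          refine MeasureTheory.setIntegral_mono_on (hc.integrableOn_uIoc) (hc'.integrableOn_uIoc)
            measurableSet_uIoc fun u _ => ?_
          calc ‖dysonTerm F n u * F u‖ ≤ ‖dysonTerm F n u‖ * ‖F u‖ := norm_mul_le _ _
            _ ≤ ((M * |u|) ^ n / n.factorial) * M := by gcongr; exacts [ih u, hM u]
            _ = _ := by rw [sub_zero, mul_pow, pow_succ]; ring
      _ = (M * |s|) ^ (n + 1) / (n + 1).factorial := by
          rw [MeasureTheory.integral_const_mul, integral_pow_abs_sub_uIoc, sub_zero,
            Nat.factorial_succ, mul_pow]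
          push_cast
          field_simp

/-- The linear equation `ξ' = ξ F` with bounded continuous coefficient has a global solution. -/
theorem exists_linear_ode_solution [CompleteSpace A] [NormOneClass A] {F : ℝ → A} (hF : Continuous F) {M : ℝ}
    (hM : ∀ s, ‖F s‖ ≤ M) :
    ∃ ξ : ℝ → A, ξ 0 = 1 ∧ (∀ s, HasDerivAt ξ (ξ s * F s) s) ∧
      ∀ s, ‖ξ s‖ ≤ Real.exp (M * |s|) := by
  have hM0 : 0 ≤ M := (norm_nonneg _).trans (hM 0)
  have hexp : ∀ x : ℝ, HasSum (fun n : ℕ => x ^ n / n.factorial) (Real.exp x) := fun x => by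
    rw [Real.exp_eq_exp_ℝ]
    exact NormedSpace.expSeries_div_hasSum_exp x
  have hsum : ∀ s, Summable fun n => dysonTerm F n s := fun s =>
    Summable.of_norm_bounded (hexp (M * |s|)).summable (norm_dysonTerm_le hF hM · s)
  have hsum' : ∀ s, Summable fun n => dysonTerm F (n + 1) s := fun s =>
    (summable_nat_add_iff 1).2 (hsum s)
  have hξ : ∀ s, ∑' n, dysonTerm F n s = 1 + ∑' n, dysonTerm F (n + 1) s := fun s =>
    (hsum s).tsum_eq_zero_add
  refine ⟨fun s => ∑' n, dysonTerm F n s, ?_, fun s => ?_, fun s => ?_⟩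
  · simp [hξ, dysonTerm]
  · have hd : HasDerivAt (fun z => ∑' n, dysonTerm F (n + 1) z)
        (∑' n, dysonTerm F n s * F s) s := by
      -- The derivative of term $n+1$ is term $n$ times $F$, so on a ball around 0 containing $s$
      -- the differentiated series is dominated by an exponential series.
      refine hasDerivAt_tsum_of_isPreconnected (t := Metric.ball 0 (|s| + 1))
        (u := fun n => (M * (|s| + 1)) ^ n / n.factorial * M) (y₀ := (0 : ℝ)) (y := s)
        (g := fun n => dysonTerm F (n + 1)) (g' := fun n y => dysonTerm F n y * F y)
        ((hexp (M * (|s| + 1))).summable.mul_right M) Metric.isOpen_ball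
        (convex_ball (0 : ℝ) (|s| + 1)).isPreconnected
        (fun n y _ => hasDerivAt_dysonTerm_succ hF n y) (fun n y hy => ?_)
        (Metric.mem_ball_self (by positivity)) (hsum' 0) ?_
      · have hy' : |y| ≤ |s| + 1 := by simpa using (Metric.mem_ball.1 hy).le
        refine (norm_mul_le _ _).trans ?_
        gcongr
        · exact (norm_dysonTerm_le hF hM n y).trans (by gcongr)
        · exact hM y
      · simp
    simp_rw [hξ]
    rw [← hξ, ← (hsum s).tsum_mul_right]
    exact hd.const_add 1
  · exact tsum_of_norm_bounded (hexp _) (norm_dysonTerm_le hF hM · s)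

/-- Stability of `ξ' = ξ F` under perturbations of the coefficient. -/
theorem norm_linear_ode_sub_le {F G ξ ζ : ℝ → A} {M ε : ℝ} (hMpos : 0 < M)
    (hξ0 : ξ 0 = ζ 0) (hξ : ∀ s, HasDerivAt ξ (ξ s * F s) s)
    (hζ : ∀ s, HasDerivAt ζ (ζ s * G s) s) (hF : ∀ s, ‖F s‖ ≤ M)
    (hζM : ∀ s, ‖ζ s‖ ≤ Real.exp (M * |s|)) (hFG : ∀ s, ‖F s - G s‖ ≤ M * ε) :
    ‖ξ 1 - ζ 1‖ ≤ ε * Real.exp (2 * M) := by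
  have hε : 0 ≤ ε := by
    have := (norm_nonneg _).trans (hFG 0)
    exact nonneg_of_mul_nonneg_right this hMpos
  have hd : ∀ s, HasDerivAt (fun s => ξ s - ζ s) (ξ s * F s - ζ s * G s) s := fun s =>
    (hξ s).sub (hζ s)
  -- The inhomogeneity is $\zeta(F-G)$, of norm at most $e^M\cdot M\varepsilon$. Gronwall divides it
  -- by $M$, which is why the distance of $F$ and $G$ is measured in units of $M$.
  have h := norm_le_gronwallBound_of_norm_deriv_right_le (f := fun s => ξ s - ζ s) (a := 0) (b := 1)
    (δ := 0) (K := M) (ε := Real.exp M * (M * ε))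
    (fun s _ => (hd s).continuousAt.continuousWithinAt) (fun s _ => (hd s).hasDerivWithinAt)
    (by simp [hξ0]) (fun s hs => ?_) 1 (by simp)
  · rw [gronwallBound_of_K_ne_0 hMpos.ne'] at h
    refine h.trans ?_
    simp only [zero_mul, zero_add, sub_zero, mul_one, two_mul, Real.exp_add]
    calc Real.exp M * (M * ε) / M * (Real.exp M - 1) = Real.exp M * ε * (Real.exp M - 1) := by
          field_simp
      _ ≤ Real.exp M * ε * Real.exp M := by gcongr; linarith
      _ = _ := by ring
  · have h1 : ξ s * F s - ζ s * G s = (ξ s - ζ s) * F s + ζ s * (F s - G s) := by noncomm_ring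
    rw [h1]
    have hs1 : |s| ≤ 1 := abs_le.2 ⟨by linarith [hs.1], hs.2.le⟩
    refine (norm_add_le _ _).trans (add_le_add ?_ ?_)
    · rw [mul_comm M]
      exact (norm_mul_le _ _).trans (by gcongr; exact hF s)
    · refine (norm_mul_le _ _).trans ?_
      gcongr
      · exact (hζM s).trans (Real.exp_le_exp.2 (by nlinarith))
      · exact hFG s

end Dyson

/-! ### Heisenberg evolution and a Lieb–Robinson estimate -/

section Evolution

variable {A : Type*} [CStarAlgebra A]

/-- The one-parameter group `e^{ith}`. -/
noncomputable def propagator (h : A) (t : ℝ) : A :=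
  NormedSpace.exp (t • (Complex.I • h))

theorem hasDerivAt_propagator (h : A) (t : ℝ) :
    HasDerivAt (propagator h) (propagator h t * (Complex.I • h)) t :=
  hasDerivAt_exp_smul_const (𝕂 := ℝ) (Complex.I • h) t

theorem hasDerivAt_propagator' (h : A) (t : ℝ) :
    HasDerivAt (propagator h) ((Complex.I • h) * propagator h t) t :=
  hasDerivAt_exp_smul_const' (𝕂 := ℝ) (Complex.I • h) t

theorem hasDerivAt_propagator_neg (h : A) (t : ℝ) :
    HasDerivAt (fun s => propagator h (-s)) (-(propagator h (-t) * (Complex.I • h))) t := by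
  have := (hasDerivAt_propagator h (-t)).scomp t (hasDerivAt_neg t)
  rw [neg_one_smul] at this
  exact this

@[simp]
theorem propagator_zero (h : A) : propagator h 0 = 1 := by
  simp [propagator, NormedSpace.exp_zero]

theorem propagator_add (h : A) (s t : ℝ) :
    propagator h (s + t) = propagator h s * propagator h t := by
  let _ : NormedAlgebra ℚ A := NormedAlgebra.restrictScalars ℚ ℂ A
  rw [propagator, add_smul, NormedSpace.exp_add_of_commute]
  · rfl
  · exact ((Commute.refl _).smul_left _).smul_right _

@[simp]
theorem propagator_mul_neg (h : A) (t : ℝ) : propagator h t * propagator h (-t) = 1 := by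
  rw [← propagator_add, add_neg_cancel, propagator_zero]

@[simp]
theorem propagator_neg_mul (h : A) (t : ℝ) : propagator h (-t) * propagator h t = 1 := by
  rw [← propagator_add, neg_add_cancel, propagator_zero]

theorem propagator_neg_left (h : A) (t : ℝ) : propagator (-h) t = propagator h (-t) := by
  simp [propagator]

theorem star_propagator {h : A} (hh : IsSelfAdjoint h) (t : ℝ) :
    star (propagator h t) = propagator h (-t) := by
  rw [propagator, NormedSpace.star_exp, propagator]
  simp [hh.star_eq]

theorem norm_propagator_le [Nontrivial A] {h : A} (hh : IsSelfAdjoint h) (t : ℝ) :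
    ‖propagator h t‖ ≤ 1 := by
  refine (CStarRing.norm_of_mem_unitary ?_).le
  rw [Unitary.mem_iff]
  simp [star_propagator hh]

theorem continuous_uncurry_propagator :
    Continuous fun x : A × ℝ => propagator x.1 x.2 := by
  let _ : NormedAlgebra ℚ A := NormedAlgebra.restrictScalars ℚ ℂ A
  unfold propagator
  exact NormedSpace.exp_continuous.comp (by fun_prop)

/-- The Heisenberg evolution `e^{ith} V e^{-ith}`. -/
noncomputable def evol (h : A) (t : ℝ) (V : A) : A :=
  propagator h t * V * propagator h (-t)

theorem evol_neg_left (h V : A) (t : ℝ) : evol (-h) t V = evol h (-t) V := by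
  simp [evol, propagator_neg_left]

theorem evol_sub (h : A) (t : ℝ) (V W : A) : evol h t (V - W) = evol h t V - evol h t W := by
  simp [evol, mul_sub, sub_mul]

theorem evol_evol_neg (h : A) (t : ℝ) (V : A) : evol h t (evol h (-t) V) = V := by
  have : evol h t (evol h (-t) V) =
      (propagator h t * propagator h (-t)) * V * (propagator h t * propagator h (-t)) := by
    simp only [evol, neg_neg, mul_assoc]
  simp [this]

theorem norm_evol_le [Nontrivial A] {h : A} (hh : IsSelfAdjoint h) (t : ℝ) (V : A) :
    ‖evol h t V‖ ≤ ‖V‖ := by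
  have h1 := norm_propagator_le hh t
  have h2 := norm_propagator_le hh (-t)
  calc ‖evol h t V‖ ≤ ‖propagator h t‖ * ‖V‖ * ‖propagator h (-t)‖ := norm_mul₃_le
    _ ≤ 1 * ‖V‖ * 1 := by gcongr
    _ = ‖V‖ := by ring

theorem continuous_uncurry_evol (V : A) : Continuous fun x : A × ℝ => evol x.1 x.2 V := by
  unfold evol
  have h1 := continuous_uncurry_propagator (A := A)
  have h2 : Continuous fun x : A × ℝ => propagator x.1 (-x.2) :=
    h1.comp (by fun_prop : Continuous fun x : A × ℝ => (x.1, -x.2))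
  exact (h1.mul continuous_const).mul h2

theorem continuous_evol (h V : A) : Continuous fun t => evol h t V :=
  (continuous_uncurry_evol V).comp (by fun_prop : Continuous fun t : ℝ => (h, t))

/-- Duhamel comparison of two evolutions. -/
theorem norm_evol_sub_le_of_comm [Nontrivial A] {h k : A} (hh : IsSelfAdjoint h) (V : A)
    {B B' : ℝ → ℝ} (hB : ∀ s, HasDerivAt B (B' s) s) (hB0 : 0 ≤ B 0)
    (hcomm : ∀ s, 0 ≤ s → ‖(h - k) * evol k s V - evol k s V * (h - k)‖ ≤ B' s)
    {t : ℝ} (ht : 0 ≤ t) : ‖evol h t V - evol k t V‖ ≤ B t := by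
  -- Interaction picture: the derivative is the commutator of $h-k$ with the $k$-evolved observable,
  -- conjugated by unitaries. A comparison function $B$ avoids integrating the bound.
  set f : ℝ → A := fun s => (propagator h (-s) * propagator k s) * V *
    (propagator k (-s) * propagator h s) - V with hf
  have hd : ∀ s, HasDerivAt f (-(Complex.I •
      evol h (-s) ((h - k) * evol k s V - evol k s V * (h - k)))) s := fun s => by
    have h1 := ((((hasDerivAt_propagator_neg h s).mul (hasDerivAt_propagator' k s)).mul_const V).mul
      ((hasDerivAt_propagator_neg k s).mul (hasDerivAt_propagator' h s))).sub_const V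
    refine HasDerivAt.congr_deriv (f := f) h1 ?_
    simp only [evol, neg_neg, mul_sub, sub_mul, smul_sub, mul_assoc, smul_mul_assoc, mul_smul_comm,
      mul_add, add_mul, neg_mul, mul_neg, Pi.mul_apply]
    abel
  have hfB : ‖f t‖ ≤ B t := by
    refine image_norm_le_of_norm_deriv_right_le_deriv_boundary (a := 0) (b := t)
      (fun s _ => (hd s).continuousAt.continuousWithinAt) (fun s _ => (hd s).hasDerivWithinAt)
      (by simpa [hf] using hB0) hB (fun s hs => ?_) ⟨ht, le_rfl⟩
    rw [norm_neg, norm_smul, Complex.norm_I, one_mul]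
    exact (norm_evol_le hh _ _).trans (hcomm s hs.1)
  have hfe : f t = evol h (-t) (evol k t V) - V := by simp only [hf, evol, neg_neg, mul_assoc]
  have : evol h t V - evol k t V = -evol h t (f t) := by
    rw [hfe, evol_sub, evol_evol_neg]; abel
  rw [this, norm_neg]
  exact (norm_evol_le hh _ _).trans hfB

/-- By strong induction on $n$: split the evolution under $h_n$ into its increments. The increment
at level $k+1$ has size $q^{k+1}$ by induction and meets $h_{n+1}-h_n$ with strength $q^{2(n-k)}$,
so its contribution is $q^{n+1}q^{n-k}$. Half of the decay rate is spent on summing over $k$; the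
sum $1/(1-q)$ enters the velocity. -/
theorem norm_evol_succ_sub_le_of_nonneg [Nontrivial A] {h : ℕ → A}
    (hh : ∀ n, IsSelfAdjoint (h n)) {V : A} {S : ℕ → AddSubgroup A} (hS : Monotone S)
    (hmem : ∀ n t, evol (h n) t V ∈ S n) {K q : ℝ} (hK : 0 ≤ K) (hq0 : 0 < q) (hq1 : q < 1)
    (hcomm : ∀ n k, k ≤ n → ∀ X ∈ S k,
      ‖(h (n + 1) - h n) * X - X * (h (n + 1) - h n)‖ ≤ K * q ^ (2 * (n + 1 - k)) * ‖X‖)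
    (n : ℕ) : ∀ t : ℝ, 0 ≤ t → ‖evol (h (n + 1)) t V - evol (h n) t V‖ ≤
      ‖V‖ * Real.exp (K / (1 - q) * t) * q ^ (n + 1) := by
  induction n using Nat.strong_induction_on with
  | _ n ih =>
  intro t ht
  have hq2 : 0 < 1 - q := by linarith
  set v := K / (1 - q) with hv
  have hv0 : 0 ≤ v := by positivity
  refine norm_evol_sub_le_of_comm (hh _) V
    (B := fun t => ‖V‖ * Real.exp (v * t) * q ^ (n + 1))
    (B' := fun t => ‖V‖ * (Real.exp (v * t) * (v * 1)) * q ^ (n + 1)) (fun s => ?_)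
    (by positivity) (fun s hs => ?_) ht
  · exact ((((hasDerivAt_id s).const_mul v).exp).const_mul _).mul_const _
  · set w := h (n + 1) - h n
    have hsplit : evol (h n) s V = evol (h 0) s V +
        ∑ k ∈ Finset.range n, (evol (h (k + 1)) s V - evol (h k) s V) := by
      rw [Finset.sum_range_sub (fun k => evol (h k) s V)]; abel
    have hexp : 1 ≤ Real.exp (v * s) := Real.one_le_exp (by positivity)
    have hterm : ∀ k ∈ Finset.range n,
        ‖w * (evol (h (k + 1)) s V - evol (h k) s V) - (evol (h (k + 1)) s V - evol (h k) s V) * w‖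
          ≤ K * ‖V‖ * Real.exp (v * s) * q ^ (n + 1) * q ^ (n - k) := fun k hk => by
      have hk := Finset.mem_range.1 hk
      refine (hcomm n (k + 1) hk _ ((S (k + 1)).sub_mem (hmem _ _)
        (hS (Nat.le_succ k) (hmem _ _)))).trans ?_
      calc _ ≤ K * q ^ (2 * (n + 1 - (k + 1))) * (‖V‖ * Real.exp (v * s) * q ^ (k + 1)) := by
            gcongr; exact ih k hk s hs
        _ = K * ‖V‖ * Real.exp (v * s) * (q ^ (2 * (n + 1 - (k + 1))) * q ^ (k + 1)) := by ring
        _ = _ := by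
            rw [mul_assoc _ (q ^ (n + 1)), ← pow_add, ← pow_add]
            congr 2; omega
    have h0 : ‖w * evol (h 0) s V - evol (h 0) s V * w‖ ≤
        K * ‖V‖ * Real.exp (v * s) * q ^ (n + 1) * q ^ (n + 1) := by
      refine (hcomm n 0 (Nat.zero_le n) _ (hmem _ _)).trans ?_
      calc _ ≤ K * q ^ (2 * (n + 1 - 0)) * (‖V‖ * Real.exp (v * s)) := by
            gcongr
            exact (norm_evol_le (hh 0) _ _).trans (le_mul_of_one_le_right (norm_nonneg _) hexp)
        _ = _ := by rw [Nat.sub_zero, two_mul, pow_add]; ring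
    have hgeom : q ^ (n + 1) + ∑ k ∈ Finset.range n, q ^ (n - k) ≤ 1 / (1 - q) := by
      have h1 : q ^ (n + 1) + ∑ k ∈ Finset.range n, q ^ (n - k) ≤
          ∑ k ∈ Finset.range (n + 2), q ^ k := by
        rw [Finset.sum_range_succ, add_comm (∑ _ ∈ _, _)]
        gcongr
        have h2 : ∑ k ∈ Finset.range n, q ^ (n - k) = ∑ k ∈ Finset.range n, q ^ (k + 1) := by
          rw [← Finset.sum_range_reflect (fun k => q ^ (k + 1)) n]
          refine Finset.sum_congr rfl fun k hk => ?_
          have := Finset.mem_range.1 hk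
          congr 1; omega
        rw [h2, Finset.sum_range_succ']
        exact le_add_of_nonneg_right (by positivity)
      refine h1.trans ?_
      rw [geom_sum_eq hq1.ne, ← neg_div_neg_eq, neg_sub, neg_sub]
      gcongr
      linarith [pow_pos hq0 (n + 2)]
    calc ‖w * evol (h n) s V - evol (h n) s V * w‖
        = ‖(w * evol (h 0) s V - evol (h 0) s V * w) + ∑ k ∈ Finset.range n,
            (w * (evol (h (k + 1)) s V - evol (h k) s V) -
              (evol (h (k + 1)) s V - evol (h k) s V) * w)‖ := by
          rw [Finset.sum_sub_distrib, ← Finset.mul_sum, ← Finset.sum_mul, hsplit, mul_add, add_mul]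
          congr 1; abel
      _ ≤ K * ‖V‖ * Real.exp (v * s) * q ^ (n + 1) * q ^ (n + 1) + ∑ k ∈ Finset.range n,
            K * ‖V‖ * Real.exp (v * s) * q ^ (n + 1) * q ^ (n - k) :=
          (norm_add_le _ _).trans (add_le_add h0 ((norm_sum_le _ _).trans (Finset.sum_le_sum hterm)))
      _ = K * ‖V‖ * Real.exp (v * s) * q ^ (n + 1) *
            (q ^ (n + 1) + ∑ k ∈ Finset.range n, q ^ (n - k)) := by
          rw [← Finset.mul_sum]; ring
      _ ≤ K * ‖V‖ * Real.exp (v * s) * q ^ (n + 1) * (1 / (1 - q)) := by gcongr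
      _ = _ := by rw [hv]; ring

/-- Locality of the evolution generated by a nested sequence of Hamiltonians whose increments
almost commute with the observables of the inner regions. -/
theorem norm_evol_succ_sub_le [Nontrivial A] {h : ℕ → A}
    (hh : ∀ n, IsSelfAdjoint (h n)) {V : A} {S : ℕ → AddSubgroup A} (hS : Monotone S)
    (hmem : ∀ n t, evol (h n) t V ∈ S n) {K q : ℝ} (hK : 0 ≤ K) (hq0 : 0 < q) (hq1 : q < 1)
    (hcomm : ∀ n k, k ≤ n → ∀ X ∈ S k,
      ‖(h (n + 1) - h n) * X - X * (h (n + 1) - h n)‖ ≤ K * q ^ (2 * (n + 1 - k)) * ‖X‖)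
    (n : ℕ) (t : ℝ) : ‖evol (h (n + 1)) t V - evol (h n) t V‖ ≤
      ‖V‖ * Real.exp (K / (1 - q) * |t|) * q ^ (n + 1) := by
  rcases le_total 0 t with ht | ht
  · rw [abs_of_nonneg ht]
    exact norm_evol_succ_sub_le_of_nonneg hh hS hmem hK hq0 hq1 hcomm n t ht
  -- Negative times are positive times of the sequence $-h_n$.
  · have := norm_evol_succ_sub_le_of_nonneg (h := fun n => -h n) (fun n => (hh n).neg) hS (V := V)
      (fun n t => by rw [evol_neg_left]; exact hmem n _) hK hq0 hq1 (fun n k hk X hX => by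
        have h1 : (-h (n + 1) - -h n) * X - X * (-h (n + 1) - -h n) =
            -((h (n + 1) - h n) * X - X * (h (n + 1) - h n)) := by noncomm_ring
        rw [h1, norm_neg]
        exact hcomm n k hk X hX) n (-t) (by linarith)
    simpa only [evol_neg_left, neg_neg, abs_of_nonpos ht] using this

end Evolution

/-! ### The Gaussian kernel and its moments -/

section Kernel

open MeasureTheory

/-- The Gaussian kernel with `∫ p(s) e^{iωs} ds = e^{-βω/2 - β²ω²/8}`. -/
noncomputable def gaussKernel (β s : ℝ) : ℂ :=
  (√(2 / β ^ 2 / Real.pi) * Real.exp (1 / 2) : ℝ) *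
    (Complex.exp (Complex.I * (2 / β : ℝ) * s) * Complex.exp (-(2 / β ^ 2 : ℝ) * s ^ 2))

theorem continuous_gaussKernel (β : ℝ) : Continuous (gaussKernel β) := by
  unfold gaussKernel
  fun_prop

theorem norm_gaussKernel (β s : ℝ) : ‖gaussKernel β s‖ =
    √(2 / β ^ 2 / Real.pi) * Real.exp (1 / 2) * Real.exp (-(2 / β ^ 2) * s ^ 2) := by
  have h1 : ‖Complex.exp (Complex.I * (2 / β : ℝ) * s)‖ = 1 := by
    rw [mul_assoc, mul_comm, ← Complex.ofReal_mul, Complex.norm_exp_ofReal_mul_I]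
  have h2 : ‖Complex.exp (-(2 / β ^ 2 : ℝ) * s ^ 2)‖ = Real.exp (-(2 / β ^ 2) * s ^ 2) := by
    rw [Complex.norm_exp]; congr 1; norm_cast
  rw [gaussKernel, norm_mul, norm_mul, h1, h2, one_mul, Complex.norm_real, Real.norm_of_nonneg]
  positivity

theorem integral_gaussKernel_mul_exp {β : ℝ} (hβ : 0 < β) (ω : ℝ) :
    ∫ s, gaussKernel β s * Complex.exp (Complex.I * ω * s) =
      Complex.exp (-(β * ω / 2) - β ^ 2 * ω ^ 2 / 8) := by
  have hb : 0 < 2 / β ^ 2 := by positivity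
  have hF := fourierIntegral_gaussian (b := ((2 / β ^ 2 : ℝ) : ℂ)) (by rwa [Complex.ofReal_re])
    ((ω + 2 / β : ℝ) : ℂ)
  have h1 : ∀ s : ℝ, gaussKernel β s * Complex.exp (Complex.I * ω * s) =
      (√(2 / β ^ 2 / Real.pi) * Real.exp (1 / 2) : ℝ) *
      (Complex.exp (Complex.I * ((ω + 2 / β : ℝ) : ℂ) * s) *
        Complex.exp (-(2 / β ^ 2 : ℝ) * s ^ 2)) := fun s => by
    have : Complex.I * ((ω + 2 / β : ℝ) : ℂ) * s =
        Complex.I * (2 / β : ℝ) * s + Complex.I * ω * s := by push_cast; ring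
    rw [gaussKernel, this, Complex.exp_add]; ring
  simp_rw [h1]
  rw [integral_const_mul, hF]
  have h2 : ((Real.pi : ℂ) / ((2 / β ^ 2 : ℝ) : ℂ)) ^ (1 / 2 : ℂ) =
      ((√(Real.pi / (2 / β ^ 2)) : ℝ) : ℂ) := by
    rw [Real.sqrt_eq_rpow, Complex.ofReal_cpow (by positivity)]
    push_cast; rfl
  -- Completing the square: the phase $e^{2is/\beta}$ shifts the frequency and creates the linear
  -- term $-\beta\omega/2$; the prefactor $e^{1/2}$ compensates the remaining constant.
  have h3 : -((ω + 2 / β : ℝ) : ℂ) ^ 2 / (4 * ((2 / β ^ 2 : ℝ) : ℂ)) =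
      (-(1 / 2) : ℝ) + (-(β * ω / 2) - β ^ 2 * ω ^ 2 / 8) := by
    have : (β : ℂ) ≠ 0 := by exact_mod_cast hβ.ne'
    push_cast; field_simp; ring
  have h4 : √(2 / β ^ 2 / Real.pi) * √(Real.pi / (2 / β ^ 2)) = 1 := by
    rw [← Real.sqrt_mul (by positivity)]
    rw [show 2 / β ^ 2 / Real.pi * (Real.pi / (2 / β ^ 2)) = 1 by
      have := Real.pi_ne_zero
      field_simp]
    simp
  have h5 : Real.exp (1 / 2) * Real.exp (-(1 / 2)) = 1 := by rw [← Real.exp_add]; simp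
  rw [h2, h3, Complex.exp_add, ← mul_assoc, ← mul_assoc, ← Complex.ofReal_mul, ← Complex.ofReal_exp,
    ← Complex.ofReal_mul]
  have : √(2 / β ^ 2 / Real.pi) * Real.exp (1 / 2) * √(Real.pi / (2 / β ^ 2)) *
      Real.exp (-(1 / 2)) = 1 := by
    rw [mul_right_comm _ (Real.exp (1 / 2)), h4, one_mul, h5]
  rw [this]; simp

/-- A Gaussian beats $e^{v|s|}$ for every $v$, so an arbitrary Lieb–Robinson velocity is admissible.
Half of the Gaussian exponent absorbs $(v+1)|s|$ by completing the square. -/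
theorem integrable_norm_gaussKernel_mul {β : ℝ} (hβ : 0 < β) (v : ℝ) :
    Integrable fun s => ‖gaussKernel β s‖ * (|s| * Real.exp (v * |s|)) := by
  set b := 2 / β ^ 2 with hb
  have hb0 : 0 < b := by positivity
  have hg := (integrable_exp_neg_mul_sq (b := b / 2) (by positivity)).const_mul
    (√(b / Real.pi) * Real.exp (1 / 2) * Real.exp ((v + 1) ^ 2 / (2 * b)))
  refine hg.mono' ?_ (Filter.Eventually.of_forall fun s => ?_)
  · exact ((continuous_gaussKernel β).norm.mul (by fun_prop)).aestronglyMeasurable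
  · rw [Real.norm_of_nonneg (by positivity), norm_gaussKernel, ← hb,
      mul_assoc (√(b / Real.pi) * _), mul_assoc (√(b / Real.pi) * _)]
    refine mul_le_mul_of_nonneg_left ?_ (by positivity)
    have h1 : |s| ≤ Real.exp |s| := by linarith [Real.add_one_le_exp |s|]
    calc Real.exp (-b * s ^ 2) * (|s| * Real.exp (v * |s|))
        ≤ Real.exp (-b * s ^ 2) * (Real.exp |s| * Real.exp (v * |s|)) := by gcongr
      _ = Real.exp (-b * s ^ 2 + (v + 1) * |s|) := by
          rw [← Real.exp_add, ← Real.exp_add]; congr 1; ring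
      _ ≤ Real.exp ((v + 1) ^ 2 / (2 * b) + -(b / 2) * s ^ 2) := by
          refine Real.exp_le_exp.2 ?_
          have h2 : 0 ≤ (b * |s| - (v + 1)) ^ 2 / (2 * b) := by positivity
          have h3 : (b * |s| - (v + 1)) ^ 2 / (2 * b) =
              b / 2 * s ^ 2 - (v + 1) * |s| + (v + 1) ^ 2 / (2 * b) := by
            rw [← sq_abs s]; field_simp; ring
          linarith
      _ = _ := Real.exp_add _ _

/-- The exact value is $\beta\sqrt{e/(2\pi)}$, about $0.658\,\beta$. The value $\frac23$ is what the
exponent $3\beta\|V\|$ of the theorem allows. -/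
theorem integral_norm_gaussKernel_mul_abs_le {β : ℝ} (hβ : 0 < β) :
    ∫ s, ‖gaussKernel β s‖ * |s| ≤ 2 / 3 * β := by
  set b := 2 / β ^ 2 with hb
  have hb0 : 0 < b := by positivity
  have h1 : ∫ s in Set.Ioi (0 : ℝ), s * Real.exp (-b * s ^ 2) = (2 * b)⁻¹ := by
    have := integral_mul_cexp_neg_mul_sq (b := (b : ℂ)) (by simpa using hb0)
    have h2 : ∀ s : ℝ, (s : ℂ) * Complex.exp (-b * (s : ℂ) ^ 2) =
        ((s * Real.exp (-b * s ^ 2) : ℝ) : ℂ) := fun s => by push_cast; rfl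
    simp_rw [h2] at this
    rw [integral_complex_ofReal] at this
    exact_mod_cast this
  have h2 : ∫ s, ‖gaussKernel β s‖ * |s| =
      √(b / Real.pi) * Real.exp (1 / 2) * b⁻¹ := by
    have h3 : ∀ s : ℝ, ‖gaussKernel β s‖ * |s| = √(b / Real.pi) * Real.exp (1 / 2) *
        (|s| * Real.exp (-b * |s| ^ 2)) := fun s => by
      rw [norm_gaussKernel, sq_abs]; ring
    simp_rw [h3]
    rw [integral_const_mul, integral_comp_abs (f := fun s => s * Real.exp (-b * s ^ 2)), h1]
    congr 1; field_simp
  rw [h2]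
  have hpi := Real.pi_gt_three
  -- This is $e/(2\pi)\le(2/3)^2$.
  have he : Real.exp 1 * 9 ≤ 8 * Real.pi := by
    have := Real.exp_one_lt_d9
    have := Real.pi_gt_d6
    linarith
  have h4 : √(b / Real.pi) * Real.exp (1 / 2) * b⁻¹ = β * √(Real.exp 1 / (2 * Real.pi)) := by
    have e1 : Real.exp (1 / 2) = √(Real.exp 1) := by
      rw [Real.exp_half]
    have e2 : b⁻¹ = β * √(β ^ 2 / 4) := by
      rw [show β ^ 2 / 4 = (β / 2) ^ 2 by ring, Real.sqrt_sq (by positivity), hb]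
      field_simp
    rw [e1, e2, ← Real.sqrt_mul (by positivity), mul_left_comm, ← Real.sqrt_mul (by positivity)]
    congr 2; rw [hb]; field_simp; norm_num
  rw [h4, mul_comm]
  gcongr
  rw [Real.sqrt_le_left (by norm_num), div_le_iff₀ (by positivity)]
  linarith

end Kernel

/-! ### Averaging against the kernel -/

section Average

open MeasureTheory

variable {E : Type*} [NormedAddCommGroup E] [NormedSpace ℂ E]

/-- The average `i ∫ p(s) ∫_0^s f(t) dt ds`. -/
noncomputable def kernelAvg (β : ℝ) (f : ℝ → E) : E :=
  Complex.I • ∫ s, gaussKernel β s • ∫ t in (0 : ℝ)..s, f t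

theorem norm_intervalIntegral_le_of_exp {f : ℝ → E} {C v : ℝ} (hv : 0 ≤ v)
    (hC : ∀ t, ‖f t‖ ≤ C * Real.exp (v * |t|)) (s : ℝ) :
    ‖∫ t in (0 : ℝ)..s, f t‖ ≤ C * (|s| * Real.exp (v * |s|)) := by
  have hC0 : 0 ≤ C := by simpa using (norm_nonneg _).trans (hC 0)
  have := intervalIntegral.norm_integral_le_of_norm_le_const (a := 0) (b := s) (f := f)
    (C := C * Real.exp (v * |s|)) fun t ht => (hC t).trans (by
      have h1 : |t| ≤ |s| := by
        simpa using Set.abs_sub_left_of_mem_uIcc (Set.uIoc_subset_uIcc ht)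
      gcongr)
  rw [sub_zero] at this
  linarith

theorem norm_smul_intervalIntegral_le {f : ℝ → E} {C v : ℝ} (hv : 0 ≤ v)
    (hC : ∀ t, ‖f t‖ ≤ C * Real.exp (v * |t|)) (β s : ℝ) :
    ‖gaussKernel β s • ∫ t in (0 : ℝ)..s, f t‖ ≤
      C * (‖gaussKernel β s‖ * (|s| * Real.exp (v * |s|))) := by
  rw [norm_smul, mul_left_comm]
  gcongr
  exact norm_intervalIntegral_le_of_exp hv hC s

theorem continuous_smul_intervalIntegral {f : ℝ → E} (hf : Continuous f) (β : ℝ) :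
    Continuous fun s => gaussKernel β s • ∫ t in (0 : ℝ)..s, f t :=
  (continuous_gaussKernel β).smul
    (intervalIntegral.continuous_primitive (fun a b => hf.intervalIntegrable a b) 0)

theorem integrable_smul_intervalIntegral {β : ℝ} (hβ : 0 < β) {f : ℝ → E} (hf : Continuous f)
    {C v : ℝ} (hv : 0 ≤ v) (hC : ∀ t, ‖f t‖ ≤ C * Real.exp (v * |t|)) :
    Integrable fun s => gaussKernel β s • ∫ t in (0 : ℝ)..s, f t :=
  ((integrable_norm_gaussKernel_mul hβ v).const_mul C).mono'
    (continuous_smul_intervalIntegral hf β).aestronglyMeasurable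
    (Filter.Eventually.of_forall fun s => norm_smul_intervalIntegral_le hv hC β s)

theorem norm_kernelAvg_le_of_exp {β : ℝ} (hβ : 0 < β) {f : ℝ → E}
    {C v : ℝ} (hv : 0 ≤ v) (hC : ∀ t, ‖f t‖ ≤ C * Real.exp (v * |t|)) :
    ‖kernelAvg β f‖ ≤ C * ∫ s, ‖gaussKernel β s‖ * (|s| * Real.exp (v * |s|)) := by
  rw [kernelAvg, norm_smul, Complex.norm_I, one_mul, ← integral_const_mul]
  exact norm_integral_le_of_norm_le ((integrable_norm_gaussKernel_mul hβ v).const_mul C)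
    (Filter.Eventually.of_forall fun s => norm_smul_intervalIntegral_le hv hC β s)

theorem norm_kernelAvg_le {β : ℝ} (hβ : 0 < β) {f : ℝ → E} {C : ℝ} (hC : ∀ t, ‖f t‖ ≤ C) :
    ‖kernelAvg β f‖ ≤ 2 / 3 * β * C := by
  have hC0 := (norm_nonneg _).trans (hC 0)
  have h := norm_kernelAvg_le_of_exp hβ (f := f) (C := C) le_rfl (by simpa using hC)
  simp only [zero_mul, Real.exp_zero, mul_one] at h
  refine h.trans ?_
  rw [mul_comm]
  gcongr
  exact integral_norm_gaussKernel_mul_abs_le hβ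

theorem kernelAvg_sub {β : ℝ} (hβ : 0 < β) {f g : ℝ → E} (hf : Continuous f) (hg : Continuous g)
    {C : ℝ} (hfC : ∀ t, ‖f t‖ ≤ C) (hgC : ∀ t, ‖g t‖ ≤ C) :
    kernelAvg β f - kernelAvg β g = kernelAvg β fun t => f t - g t := by
  rw [kernelAvg, kernelAvg, kernelAvg, ← smul_sub, ← integral_sub
    (integrable_smul_intervalIntegral hβ hf le_rfl (by simpa using hfC))
    (integrable_smul_intervalIntegral hβ hg le_rfl (by simpa using hgC))]
  congr 2
  funext s
  rw [← smul_sub, intervalIntegral.integral_sub (hf.intervalIntegrable _ _)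
    (hg.intervalIntegrable _ _)]

theorem map_kernelAvg [CompleteSpace E] {F : Type*} [NormedAddCommGroup F] [NormedSpace ℂ F]
    [CompleteSpace F] (L : E →L[ℂ] F) {β : ℝ} (hβ : 0 < β) {f : ℝ → E} (hf : Continuous f)
    {C : ℝ} (hfC : ∀ t, ‖f t‖ ≤ C) : L (kernelAvg β f) = kernelAvg β fun t => L (f t) := by
  rw [kernelAvg, kernelAvg, map_smul, ← L.integral_comp_comm
    (integrable_smul_intervalIntegral hβ hf le_rfl (by simpa using hfC))]
  congr 2
  funext s
  rw [map_smul, L.intervalIntegral_comp_comm (hf.intervalIntegrable _ _)]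

theorem continuous_kernelAvg {X : Type*} [TopologicalSpace X] [FirstCountableTopology X]
    {β : ℝ} (hβ : 0 < β) {f : X → ℝ → E} (hf : Continuous (Function.uncurry f))
    {C : ℝ} (hfC : ∀ x t, ‖f x t‖ ≤ C) : Continuous fun x => kernelAvg β (f x) := by
  refine Continuous.const_smul ?_ _
  refine continuous_of_dominated (fun x => (continuous_smul_intervalIntegral
    (hf.comp (by fun_prop : Continuous fun t : ℝ => (x, t))) β).aestronglyMeasurable)
    (fun x => Filter.Eventually.of_forall fun s => norm_smul_intervalIntegral_le le_rfl
      (by simpa using hfC x) β s)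
    ((integrable_norm_gaussKernel_mul hβ 0).const_mul C) (Filter.Eventually.of_forall fun s => ?_)
  exact (intervalIntegral.continuous_parametric_intervalIntegral_of_continuous' hf 0 s).const_smul _

end Average

/-! ### The Fourier multiplier of the generator -/

section Scalar

open MeasureTheory

/-- The Fourier multiplier of the quantum belief propagation generator. -/
noncomputable def qbpMultiplier (β ω : ℝ) : ℂ :=
  kernelAvg β fun t => Complex.exp (Complex.I * ω * t)

theorem continuous_qbpMultiplier {β : ℝ} (hβ : 0 < β) : Continuous (qbpMultiplier β) := by
  refine continuous_kernelAvg hβ (f := fun ω t : ℝ => Complex.exp (Complex.I * ω * t)) (C := 1)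
    (by unfold Function.uncurry; fun_prop) fun ω t => ?_
  rw [mul_assoc, mul_comm, ← Complex.ofReal_mul, Complex.norm_exp_ofReal_mul_I]

/-- The inner integral is $(e^{i\omega s}-1)/(i\omega)$, so averaging leaves $(\hat p(\omega)-\hat
p(0))/\omega$ with $\hat p(0)=1$. -/
theorem qbpMultiplier_of_ne_zero {β : ℝ} (hβ : 0 < β) {ω : ℝ} (hω : ω ≠ 0) :
    qbpMultiplier β ω = (Complex.exp (-(β * ω / 2) - β ^ 2 * ω ^ 2 / 8) - 1) / ω := by
  have hω' : (ω : ℂ) ≠ 0 := by exact_mod_cast hω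
  have hint : Integrable (gaussKernel β) := by
    have := (integrable_exp_neg_mul_sq (b := 2 / β ^ 2) (by positivity)).const_mul
      (√(2 / β ^ 2 / Real.pi) * Real.exp (1 / 2))
    exact this.mono' (continuous_gaussKernel β).aestronglyMeasurable
      (Filter.Eventually.of_forall fun s => (norm_gaussKernel β s).le)
  have hint' : Integrable fun s => gaussKernel β s * Complex.exp (Complex.I * ω * s) := by
    refine hint.norm.mono' ((continuous_gaussKernel β).mul (by fun_prop)).aestronglyMeasurable
      (Filter.Eventually.of_forall fun s => ?_)
    rw [norm_mul, mul_assoc Complex.I, mul_comm Complex.I, ← Complex.ofReal_mul,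
      Complex.norm_exp_ofReal_mul_I, mul_one]
  have h1 : ∀ s : ℝ, gaussKernel β s • ∫ t in (0 : ℝ)..s, Complex.exp (Complex.I * ω * t) =
      (gaussKernel β s * Complex.exp (Complex.I * ω * s) - gaussKernel β s) *
        (Complex.I * ω)⁻¹ := fun s => by
    rw [integral_exp_mul_complex (mul_ne_zero Complex.I_ne_zero hω')]
    simp only [Complex.ofReal_zero, mul_zero, Complex.exp_zero, smul_eq_mul]
    ring
  have h0 : ∫ s, gaussKernel β s = 1 := by
    simpa using integral_gaussKernel_mul_exp hβ 0
  rw [qbpMultiplier, kernelAvg]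
  simp_rw [h1]
  rw [integral_mul_const, integral_sub hint' hint, h0, integral_gaussKernel_mul_exp hβ, smul_eq_mul]
  field_simp

/-- The functional equation of the multiplier. -/
theorem qbpMultiplier_add {β : ℝ} (hβ : 0 < β) (ω : ℝ) :
    qbpMultiplier β ω + Complex.exp (-(β * ω)) * star (qbpMultiplier β (-ω)) =
      -β * ∫ u in (0 : ℝ)..1, Complex.exp (-(β * ω) * u) := by
  have hc1 : Continuous fun ω : ℝ => qbpMultiplier β ω +
      Complex.exp (-(β * ω)) * star (qbpMultiplier β (-ω)) := by
    have := continuous_qbpMultiplier hβ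
    have h2 : Continuous fun ω : ℝ => qbpMultiplier β (-ω) := this.comp continuous_neg
    have h3 := h2.star
    fun_prop
  have hc2 : Continuous fun ω : ℝ => -(β : ℂ) * ∫ u in (0 : ℝ)..1, Complex.exp (-(β * ω) * u) := by
    refine continuous_const.mul ?_
    exact intervalIntegral.continuous_parametric_intervalIntegral_of_continuous'
      (f := fun ω u : ℝ => Complex.exp (-(β * ω) * u))
      (by unfold Function.uncurry; fun_prop) 0 1
  -- Both sides are continuous, so the removable singularity at $\omega=0$ needs no separate
  -- computation.
  refine congrFun (hc1.ext_on (dense_compl_singleton (0 : ℝ)) hc2 fun ω hω => ?_) ω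
  have hω : ω ≠ 0 := hω
  have hω' : (ω : ℂ) ≠ 0 := by exact_mod_cast hω
  have hβ' : (β : ℂ) ≠ 0 := by exact_mod_cast hβ.ne'
  have h1 := qbpMultiplier_of_ne_zero hβ (neg_ne_zero.2 hω)
  have h2 : star (qbpMultiplier β (-ω)) =
      (Complex.exp (β * ω / 2 - β ^ 2 * ω ^ 2 / 8) - 1) / -ω := by
    have e : Complex.exp (-(β * ((-ω : ℝ) : ℂ) / 2) - β ^ 2 * ((-ω : ℝ) : ℂ) ^ 2 / 8) =
        ((Real.exp (β * ω / 2 - β ^ 2 * ω ^ 2 / 8) : ℝ) : ℂ) := by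
      push_cast; congr 1; ring
    rw [h1, e, Complex.star_def, map_div₀, map_sub, Complex.conj_ofReal, Complex.conj_ofReal, map_one]
    push_cast; rfl
  simp only
  rw [qbpMultiplier_of_ne_zero hβ hω, h2, integral_exp_mul_complex
    (neg_ne_zero.2 (mul_ne_zero hβ' hω'))]
  -- The symmetry $e^{-\beta\omega}\hat p(-\omega)=\hat p(\omega)$: the Gaussian terms cancel and
  -- $(e^{-\beta\omega}-1)/\omega$ remains.
  have h3 : Complex.exp (-(β * ω)) * Complex.exp (β * ω / 2 - β ^ 2 * ω ^ 2 / 8) =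
      Complex.exp (-(β * ω / 2) - β ^ 2 * ω ^ 2 / 8) := by
    rw [← Complex.exp_add]; congr 1; ring
  rw [mul_div_assoc', mul_sub, h3]
  simp only [Complex.ofReal_one, Complex.ofReal_zero, mul_one, mul_zero, Complex.exp_zero]
  field_simp
  ring

end Scalar

open scoped CStarAlgebra

/-! ### Duhamel's formula -/

section Duhamel

variable {A : Type*} [NormedRing A] [NormedAlgebra ℝ A] [CompleteSpace A]

theorem exp_smul_continuous : Continuous fun x : ℝ × A => NormedSpace.exp (x.1 • x.2) := by
  let _ : NormedAlgebra ℚ A := NormedAlgebra.restrictScalars ℚ ℝ A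
  exact NormedSpace.exp_continuous.comp (by fun_prop)

/-- An exact difference formula, obtained by integrating the derivative of $u\mapsto
e^{u(c+xb)}e^{(1-u)c}$. Dividing by $x$ and letting $x\to0$ gives the derivative of the exponential.
-/
theorem exp_add_smul_sub_exp (c b : A) (x : ℝ) :
    NormedSpace.exp (c + x • b) - NormedSpace.exp c = x • ∫ u in (0 : ℝ)..1,
      NormedSpace.exp (u • (c + x • b)) * b * NormedSpace.exp ((1 - u) • c) := by
  have hd : ∀ u : ℝ, HasDerivAt
      (fun u : ℝ => NormedSpace.exp (u • (c + x • b)) * NormedSpace.exp ((1 - u) • c))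
      (x • (NormedSpace.exp (u • (c + x • b)) * b * NormedSpace.exp ((1 - u) • c))) u := fun u => by
    have h1 := hasDerivAt_exp_smul_const (𝕂 := ℝ) (c + x • b) u
    have h2 := (hasDerivAt_exp_smul_const' (𝕂 := ℝ) c (1 - u)).scomp u
      ((hasDerivAt_id u).const_sub 1)
    refine (h1.mul h2).congr_deriv ?_
    simp only [Function.comp, neg_one_smul, mul_add, add_mul, mul_neg, mul_smul_comm,
      smul_mul_assoc, mul_assoc]
    abel
  have hcont : Continuous fun u : ℝ =>
      NormedSpace.exp (u • (c + x • b)) * b * NormedSpace.exp ((1 - u) • c) := by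
    have h1 := exp_smul_continuous (A := A)
    exact ((h1.comp (by fun_prop : Continuous fun u : ℝ => (u, c + x • b))).mul
      continuous_const).mul (h1.comp (by fun_prop : Continuous fun u : ℝ => (1 - u, c)))
  rw [← intervalIntegral.integral_smul, intervalIntegral.integral_eq_sub_of_hasDerivAt
    (fun u _ => hd u) ((hcont.const_smul x).intervalIntegrable _ _)]
  simp [NormedSpace.exp_zero]

/-- Duhamel's formula for the derivative of the exponential along a line. -/
theorem hasDerivAt_exp_add_smul (a b : A) (s : ℝ) :
    HasDerivAt (fun s : ℝ => NormedSpace.exp (a + s • b))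
      (∫ u in (0 : ℝ)..1, NormedSpace.exp (u • (a + s • b)) * b *
        NormedSpace.exp ((1 - u) • (a + s • b))) s := by
  rw [hasDerivAt_iff_tendsto_slope_zero]
  set c := a + s • b with hc
  have hcont : Continuous fun x : ℝ => ∫ u in (0 : ℝ)..1,
      NormedSpace.exp (u • (c + x • b)) * b * NormedSpace.exp ((1 - u) • c) := by
    refine intervalIntegral.continuous_parametric_intervalIntegral_of_continuous' ?_ 0 1
    have h1 := exp_smul_continuous (A := A)
    exact ((h1.comp (by fun_prop : Continuous fun p : ℝ × ℝ => (p.2, c + p.1 • b))).mul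
      continuous_const).mul (h1.comp (by fun_prop : Continuous fun p : ℝ × ℝ => (1 - p.2, c)))
  have h0 := hcont.tendsto 0
  simp only [zero_smul, add_zero] at h0
  refine (h0.mono_left nhdsWithin_le_nhds).congr' ?_
  filter_upwards [self_mem_nhdsWithin] with x hx
  have h1 : a + (s + x) • b = c + x • b := by rw [hc, add_smul, add_assoc]
  rw [h1, exp_add_smul_sub_exp, inv_smul_smul₀ hx]

end Duhamel

/-! ### The belief propagation generator -/

section Generator

/-- The generator of quantum belief propagation. -/
noncomputable def qbpGenerator {A : Type*} [CStarAlgebra A] (β : ℝ) (h V : A) : A :=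
  kernelAvg β fun t => evol h t V

/-- A homomorphism of C*-algebras as a continuous linear map. -/
noncomputable def starHomCLM {A B : Type*} [CStarAlgebra A] [CStarAlgebra B] (φ : A →⋆ₐ[ℂ] B) :
    A →L[ℂ] B :=
  ⟨φ.toAlgHom.toLinearMap, map_continuous φ⟩

theorem map_propagator {A B : Type*} [CStarAlgebra A] [CStarAlgebra B] (φ : A →⋆ₐ[ℂ] B) (h : A)
    (t : ℝ) : φ (propagator h t) = propagator (φ h) t := by
  let _ : NormedAlgebra ℚ A := NormedAlgebra.restrictScalars ℚ ℂ A
  let _ : NormedAlgebra ℚ B := NormedAlgebra.restrictScalars ℚ ℂ B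
  rw [propagator, NormedSpace.map_exp φ (map_continuous φ), propagator]
  congr 1
  rw [← Complex.coe_smul, map_smul, map_smul, Complex.coe_smul]

theorem map_evol {A B : Type*} [CStarAlgebra A] [CStarAlgebra B] (φ : A →⋆ₐ[ℂ] B) (h V : A)
    (t : ℝ) : φ (evol h t V) = evol (φ h) t (φ V) := by
  simp only [evol, map_mul, map_propagator]

theorem map_qbpGenerator {A B : Type*} [CStarAlgebra A] [CStarAlgebra B] [Nontrivial A]
    (φ : A →⋆ₐ[ℂ] B) {β : ℝ} (hβ : 0 < β) {h : A} (hh : IsSelfAdjoint h) (V : A) :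
    φ (qbpGenerator β h V) = qbpGenerator β (φ h) (φ V) := by
  rw [qbpGenerator, qbpGenerator]
  simp_rw [← map_evol]
  exact map_kernelAvg (starHomCLM φ) hβ (continuous_evol h V) (norm_evol_le hh · V)

theorem norm_qbpGenerator_le {A : Type*} [CStarAlgebra A] [Nontrivial A] {β : ℝ} (hβ : 0 < β)
    {h : A} (hh : IsSelfAdjoint h) (V : A) : ‖qbpGenerator β h V‖ ≤ 2 / 3 * β * ‖V‖ :=
  norm_kernelAvg_le hβ (norm_evol_le hh · V)

theorem continuous_qbpGenerator {A : Type*} [CStarAlgebra A] [Nontrivial A] {β : ℝ} (hβ : 0 < β)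
    {X : Type*} [TopologicalSpace X] [FirstCountableTopology X] {h : X → A}
    (hh : ∀ x, IsSelfAdjoint (h x)) (hc : Continuous h) (V : A) :
    Continuous fun x => qbpGenerator β (h x) V :=
  continuous_kernelAvg hβ (f := fun x t => evol (h x) t V)
    ((continuous_uncurry_evol V).comp (by fun_prop : Continuous fun p : X × ℝ => (h p.1, p.2)))
    fun x t => norm_evol_le (hh x) t V

theorem norm_qbpGenerator_sub_le {A : Type*} [CStarAlgebra A] [Nontrivial A] {β : ℝ} (hβ : 0 < β)
    {h k : A} (hh : IsSelfAdjoint h) (hk : IsSelfAdjoint k) (V : A) {C v : ℝ} (hv : 0 ≤ v)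
    (hC : ∀ t, ‖evol h t V - evol k t V‖ ≤ C * Real.exp (v * |t|)) :
    ‖qbpGenerator β h V - qbpGenerator β k V‖ ≤
      C * ∫ s, ‖gaussKernel β s‖ * (|s| * Real.exp (v * |s|)) := by
  rw [qbpGenerator, qbpGenerator, kernelAvg_sub hβ (continuous_evol h V) (continuous_evol k V)
    (norm_evol_le hh · V) (norm_evol_le hk · V)]
  exact norm_kernelAvg_le_of_exp hβ hv hC

end Generator

/-! ### The belief propagation identity for matrices -/

section Matrix

variable {n : Type*} [Fintype n]

/-- A matrix entry as a continuous linear functional. -/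
noncomputable def entryCLM (i j : n) : Matrix n n ℂ →L[ℂ] ℂ :=
  LinearMap.toContinuousLinearMap (Matrix.entryLinearMap ℂ ℂ i j)

@[simp]
theorem entryCLM_apply (i j : n) (M : Matrix n n ℂ) : entryCLM i j M = M i j := rfl

variable [DecidableEq n]

theorem exp_smul_diagonal (z : ℂ) (e : n → ℝ) :
    NormedSpace.exp (z • (Matrix.diagonal fun i => (e i : ℂ)) : Matrix n n ℂ) =
      Matrix.diagonal fun i => Complex.exp (z * e i) := by
  rw [← Matrix.diagonal_smul, Matrix.exp_diagonal]
  congr 1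
  funext i
  rw [Pi.coe_exp, Complex.exp_eq_exp_ℂ]; rfl

/-- For diagonal $h$ the evolution multiplies the entry $V_{ij}$ by $e^{it(e_i-e_j)}$, so the
generator is an entrywise multiplier and the identity is `qbpMultiplier_add` at $\omega=e_i-e_j$,
multiplied by $e^{-\beta e_j}$. -/
theorem qbp_identity_diagonal {β : ℝ} (hβ : 0 < β) (e : n → ℝ) [Nontrivial (Matrix n n ℂ)]
    {V : Matrix n n ℂ} (hV : V.IsHermitian) :
    let h : Matrix n n ℂ := Matrix.diagonal fun i => (e i : ℂ)
    ∫ u in (0 : ℝ)..1, NormedSpace.exp (u • (-(β : ℂ) • h)) * (-(β : ℂ) • V) *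
        NormedSpace.exp ((1 - u) • (-(β : ℂ) • h)) =
      qbpGenerator β h V * NormedSpace.exp (-(β : ℂ) • h) +
        NormedSpace.exp (-(β : ℂ) • h) * star (qbpGenerator β h V) := by
  intro h
  have hh : IsSelfAdjoint h := by
    rw [IsSelfAdjoint, Matrix.star_eq_conjTranspose, Matrix.diagonal_conjTranspose]
    congr 1; funext i; simp
  have hexp : ∀ u : ℝ, NormedSpace.exp (u • (-(β : ℂ) • h)) =
      Matrix.diagonal fun i => Complex.exp (u * -β * e i) := fun u => by
    rw [← Complex.coe_smul, smul_smul, exp_smul_diagonal]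
  have hprop : ∀ t : ℝ, propagator h t =
      Matrix.diagonal fun i => Complex.exp (t * Complex.I * e i) := fun t => by
    rw [propagator, ← Complex.coe_smul, smul_smul, exp_smul_diagonal]
  have hgen : ∀ i j, qbpGenerator β h V i j = qbpMultiplier β (e i - e j) * V i j := fun i j => by
    have h1 := map_kernelAvg (entryCLM i j) hβ (continuous_evol h V) (norm_evol_le hh · V)
    have h2 := map_kernelAvg (ContinuousLinearMap.mul ℂ ℂ (V i j)) hβ
      (f := fun t : ℝ => Complex.exp (Complex.I * (e i - e j : ℝ) * t)) (C := 1) (by fun_prop)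
      fun t => by
        rw [mul_assoc, mul_comm, ← Complex.ofReal_mul, Complex.norm_exp_ofReal_mul_I]
    rw [qbpGenerator, ← entryCLM_apply i j (kernelAvg _ _), h1, mul_comm, qbpMultiplier]
    rw [ContinuousLinearMap.mul_apply'] at h2
    rw [h2]
    congr 1
    funext t
    rw [entryCLM_apply, evol, hprop, hprop, Matrix.mul_diagonal, Matrix.diagonal_mul,
      ContinuousLinearMap.mul_apply', mul_right_comm, ← Complex.exp_add, mul_comm]
    congr 2; push_cast; ring
  ext i j
  have hcont : Continuous fun u : ℝ => NormedSpace.exp (u • (-(β : ℂ) • h)) * (-(β : ℂ) • V) *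
        NormedSpace.exp ((1 - u) • (-(β : ℂ) • h)) := by
    have h1 := exp_smul_continuous (A := Matrix n n ℂ)
    exact ((h1.comp (by fun_prop : Continuous fun u : ℝ => (u, -(β : ℂ) • h))).mul
      continuous_const).mul (h1.comp (by fun_prop : Continuous fun u : ℝ => (1 - u, -(β : ℂ) • h)))
  rw [← entryCLM_apply i j (intervalIntegral _ _ _ _), ← ContinuousLinearMap.intervalIntegral_comp_comm _
    (hcont.intervalIntegrable _ _)]
  have hE := hexp 1
  rw [one_smul] at hE
  have hL : ∀ u : ℝ, entryCLM i j (NormedSpace.exp (u • (-(β : ℂ) • h)) * (-(β : ℂ) • V) *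
        NormedSpace.exp ((1 - u) • (-(β : ℂ) • h))) =
      Complex.exp (-(β * e j)) * V i j *
        (-β * Complex.exp (-(β * (e i - e j : ℝ)) * u)) := fun u => by
    rw [entryCLM_apply, hexp, hexp, Matrix.mul_diagonal, Matrix.diagonal_mul, Matrix.smul_apply,
      smul_eq_mul]
    have : Complex.exp (u * -β * e i) * Complex.exp (((1 - u : ℝ) : ℂ) * -β * e j) =
        Complex.exp (-(β * e j)) * Complex.exp (-(β * (e i - e j : ℝ)) * u) := by
      rw [← Complex.exp_add, ← Complex.exp_add]; congr 1; push_cast; ring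
    linear_combination (-β * V i j) * this
  simp_rw [hL]
  rw [intervalIntegral.integral_const_mul, intervalIntegral.integral_const_mul,
    ← qbpMultiplier_add hβ, Matrix.add_apply, hE, Matrix.mul_diagonal,
    Matrix.diagonal_mul, Matrix.star_apply, hgen, hgen, StarMul.star_mul, hV.apply i j]
  have h1 : Complex.exp (-(β * e j)) * Complex.exp (-(β * (e i - e j : ℝ))) =
      Complex.exp (((1 : ℝ) : ℂ) * -β * e i) := by
    rw [← Complex.exp_add]; congr 1; push_cast; ring
  rw [← h1, show -(e i - e j) = e j - e i by ring,
    show ((1 : ℝ) : ℂ) * -β * e j = -(β * e j) by push_cast; ring]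
  ring

theorem exists_diagonalization {h : Matrix n n ℂ} (hh : h.IsHermitian) :
    ∃ (φ : Matrix n n ℂ ≃⋆ₐ[ℂ] Matrix n n ℂ) (e : n → ℝ),
      φ h = Matrix.diagonal fun i => (e i : ℂ) := by
  refine ⟨(Unitary.conjStarAlgAut ℂ (Matrix n n ℂ) hh.eigenvectorUnitary).symm, hh.eigenvalues, ?_⟩
  refine (congrArg _ hh.spectral_theorem).trans ?_
  rw [StarAlgEquiv.symm_apply_apply]
  rfl

/-- Every ingredient is natural under *-isomorphisms, so conjugation by the eigenvector unitary
reduces to diagonal $h$. The left side is the Duhamel derivative of $e^{-\beta h}$ in direction $V$.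
-/
theorem qbp_identity {β : ℝ} (hβ : 0 < β) [Nontrivial (Matrix n n ℂ)] {h V : Matrix n n ℂ}
    (hh : h.IsHermitian) (hV : V.IsHermitian) :
    ∫ u in (0 : ℝ)..1, NormedSpace.exp (u • (-(β : ℂ) • h)) * (-(β : ℂ) • V) *
        NormedSpace.exp ((1 - u) • (-(β : ℂ) • h)) =
      qbpGenerator β h V * NormedSpace.exp (-(β : ℂ) • h) +
        NormedSpace.exp (-(β : ℂ) • h) * star (qbpGenerator β h V) := by
  let _ : NormedAlgebra ℚ (Matrix n n ℂ) := NormedAlgebra.restrictScalars ℚ ℂ _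
  obtain ⟨φ, e, he⟩ := exists_diagonalization hh
  let ψ : Matrix n n ℂ →⋆ₐ[ℂ] Matrix n n ℂ := φ
  have hψc : Continuous ψ := map_continuous ψ
  have hψV : (ψ V).IsHermitian := by
    rw [Matrix.IsHermitian, ← Matrix.star_eq_conjTranspose, ← map_star, Matrix.star_eq_conjTranspose,
      hV.eq]
  have hψe : ψ h = Matrix.diagonal fun i => (e i : ℂ) := he
  have hψr : ∀ (u : ℝ) (M : Matrix n n ℂ), ψ (u • M) = u • ψ M := fun u M => by
    rw [← Complex.coe_smul, map_smul, Complex.coe_smul]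
  have key := qbp_identity_diagonal hβ e hψV
  simp only [← hψe] at key
  have hcont : Continuous fun u : ℝ => NormedSpace.exp (u • (-(β : ℂ) • h)) * (-(β : ℂ) • V) *
        NormedSpace.exp ((1 - u) • (-(β : ℂ) • h)) := by
    have h1 := exp_smul_continuous (A := Matrix n n ℂ)
    exact ((h1.comp (by fun_prop : Continuous fun u : ℝ => (u, -(β : ℂ) • h))).mul
      continuous_const).mul (h1.comp (by fun_prop : Continuous fun u : ℝ => (1 - u, -(β : ℂ) • h)))
  have hexp : ∀ M, ψ (NormedSpace.exp M) = NormedSpace.exp (ψ M) := NormedSpace.map_exp ψ hψc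
  apply φ.injective
  change ψ _ = ψ _
  have hi := ContinuousLinearMap.intervalIntegral_comp_comm
    (starHomCLM ψ) (hcont.intervalIntegrable (μ := MeasureTheory.volume) 0 1)
  refine hi.symm.trans ?_
  change ∫ u in (0 : ℝ)..1, ψ _ = _
  simp only [map_add, map_mul, map_star, hexp, map_smul, map_qbpGenerator ψ hβ hh.isSelfAdjoint,
    ← key, hψr]

end Matrix

open scoped ComplexOrder

/-! ### Intertwining Gibbs weights and comparing expectations -/

section Matrix

theorem isHermitian_add_real_smul {n : Type*} {H V : Matrix n n ℂ} (hH : H.IsHermitian) (hV : V.IsHermitian)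
    (s : ℝ) : (H + s • V).IsHermitian := by
  refine hH.add ?_
  rw [Matrix.IsHermitian, Matrix.conjTranspose_smul, hV.eq]; simp

variable {n : Type*} [Fintype n] [DecidableEq n]

theorem hasDerivAt_exp_hamiltonian (β : ℝ) (H V : Matrix n n ℂ) (s : ℝ) :
    HasDerivAt (fun s : ℝ => NormedSpace.exp (-(β : ℂ) • (H + s • V)))
      (∫ u in (0 : ℝ)..1, NormedSpace.exp (u • (-(β : ℂ) • (H + s • V))) * (-(β : ℂ) • V) *
        NormedSpace.exp ((1 - u) • (-(β : ℂ) • (H + s • V)))) s := by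
  have h := hasDerivAt_exp_add_smul (-(β : ℂ) • H) (-(β : ℂ) • V) s
  have e : ∀ s : ℝ, -(β : ℂ) • (H + s • V) = -(β : ℂ) • H + s • (-(β : ℂ) • V) := fun s => by
    rw [smul_add, smul_comm s]
  simp only [e]
  exact h

/-- Quantum belief propagation: the solution of `ξ' = ξ Φ` intertwines the two Gibbs weights. -/
theorem exp_hamiltonian_add_eq {β : ℝ} (hβ : 0 < β) [Nontrivial (Matrix n n ℂ)]
    {H V : Matrix n n ℂ} (hH : H.IsHermitian) (hV : V.IsHermitian) {ξ : ℝ → Matrix n n ℂ}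
    (hξ0 : ξ 0 = 1)
    (hξ : ∀ s, HasDerivAt ξ (ξ s * qbpGenerator β (H + (1 - s) • V) V) s) :
    NormedSpace.exp (-(β : ℂ) • (H + V)) =
      ξ 1 * NormedSpace.exp (-(β : ℂ) • H) * star (ξ 1) := by
  set E : ℝ → Matrix n n ℂ := fun s => NormedSpace.exp (-(β : ℂ) • (H + (1 - s) • V)) with hE
  set Φ : ℝ → Matrix n n ℂ := fun s => qbpGenerator β (H + (1 - s) • V) V with hΦ
  have hEd : ∀ s, HasDerivAt E (-(Φ s * E s + E s * star (Φ s))) s := fun s => by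
    have h := (hasDerivAt_exp_hamiltonian β H V (1 - s)).scomp s ((hasDerivAt_id s).const_sub 1)
    rw [qbp_identity hβ (isHermitian_add_real_smul hH hV _) hV, neg_one_smul] at h
    exact h
  -- The path runs backwards, from $H+V$ at $s=0$ to $H$ at $s=1$, so $E'=-(\Phi E+E\Phi^*)$ cancels
  -- the derivatives of the outer factors.
  have hd : ∀ s, HasDerivAt (fun s => ξ s * E s * star (ξ s)) 0 s := fun s => by
    refine (((hξ s).mul (hEd s)).mul (hξ s).star).congr_deriv ?_
    simp only [Pi.mul_apply, StarMul.star_mul]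
    change (ξ s * Φ s * E s + ξ s * -(Φ s * E s + E s * star (Φ s))) * star (ξ s) +
      ξ s * E s * (star (Φ s) * star (ξ s)) = 0
    noncomm_ring
  have h := is_const_of_deriv_eq_zero (fun s => (hd s).differentiableAt) (fun s => (hd s).deriv) 0 1
  simpa [hE, hξ0] using h

theorem norm_entry_le_l2_opNorm (M : Matrix n n ℂ) (i j : n) : ‖M i j‖ ≤ ‖M‖ := by
  have h := Matrix.l2_opNorm_mulVec M (EuclideanSpace.single j (1 : ℂ))
  rw [PiLp.norm_single, norm_one, mul_one] at h
  refine le_trans ?_ h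
  refine le_trans (le_of_eq ?_) (PiLp.norm_apply_le _ i)
  simp

/-- In an eigenbasis of $E$ the trace is a combination of diagonal entries of a unitary conjugate of
$M$, each at most $\|M\|$, with nonnegative weights summing to the trace of $E$. -/
theorem norm_trace_mul_le_of_posSemidef {E : Matrix n n ℂ} (hE : E.PosSemidef) (M : Matrix n n ℂ) :
    ‖(E * M).trace‖ ≤ E.trace.re * ‖M‖ := by
  set U : Matrix n n ℂ := hE.1.eigenvectorUnitary.1 with hU
  set e := hE.1.eigenvalues with he
  have hUm : U ∈ unitary (Matrix n n ℂ) := hE.1.eigenvectorUnitary.2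
  have hs : E = U * Matrix.diagonal (fun i => (e i : ℂ)) * star U := by
    conv_lhs => rw [hE.1.spectral_theorem, Unitary.conjStarAlgAut_apply]
    rfl
  have htr : ∀ M : Matrix n n ℂ, (E * M).trace = ∑ i, (e i : ℂ) * (star U * M * U) i i := fun M => by
    have : (E * M).trace = (Matrix.diagonal (fun i => (e i : ℂ)) * (star U * M * U)).trace := by
      rw [hs, Matrix.trace_mul_comm, ← mul_assoc, Matrix.trace_mul_comm, ← mul_assoc,
        ← mul_assoc, ← mul_assoc, Matrix.trace_mul_comm]
      simp only [mul_assoc]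
    rw [this, Matrix.trace]
    simp [Matrix.diagonal_mul]
  have hn : ∀ M : Matrix n n ℂ, ‖star U * M * U‖ ≤ ‖M‖ := fun M => by
    rw [CStarRing.norm_mul_mem_unitary _ hUm, CStarRing.norm_mem_unitary_mul _ (Unitary.star_mem hUm)]
  have ht : E.trace.re = ∑ i, e i := by
    have := htr 1
    rw [mul_one] at this
    rw [this, mul_one, Unitary.star_mul_self_of_mem hUm]
    simp
  rw [htr, ht, Finset.sum_mul]
  refine (norm_sum_le _ _).trans (Finset.sum_le_sum fun i _ => ?_)
  rw [norm_mul, Complex.norm_real, Real.norm_of_nonneg (hE.eigenvalues_nonneg i)]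
  exact mul_le_mul_of_nonneg_left ((norm_entry_le_l2_opNorm _ i i).trans (hn M))
    (hE.eigenvalues_nonneg i)

theorem posDef_exp_smul (β : ℝ) {H : Matrix n n ℂ} (hH : H.IsHermitian) :
    (NormedSpace.exp (-(β : ℂ) • H)).PosDef := by
  have hK : (-((β / 2 : ℝ) : ℂ) • H).IsHermitian := by
    rw [Matrix.IsHermitian, Matrix.conjTranspose_smul, hH.eq]; simp
  have h : NormedSpace.exp (-(β : ℂ) • H) = (NormedSpace.exp (-((β / 2 : ℝ) : ℂ) • H)).conjTranspose *
      NormedSpace.exp (-((β / 2 : ℝ) : ℂ) • H) := by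
    rw [hK.exp.eq, ← Matrix.exp_add_of_commute _ _ (Commute.refl _), ← add_smul]
    congr 2; push_cast; ring
  have hP : (NormedSpace.exp (-(β : ℂ) • H)).PosSemidef := by
    rw [h]; exact Matrix.posSemidef_conjTranspose_mul_self _
  exact hP.posDef_iff_isUnit.2 (Matrix.isUnit_exp _)

/-- Lower bound on the ratio of the partition functions. -/
theorem exp_neg_mul_trace_le [Nonempty n] {β : ℝ} (hβ : 0 < β) {H V : Matrix n n ℂ}
    (hH : H.IsHermitian) (hV : V.IsHermitian) :
    Real.exp (-(β * ‖V‖)) * (NormedSpace.exp (-(β : ℂ) • H)).trace.re ≤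
      (NormedSpace.exp (-(β : ℂ) • (H + V))).trace.re := by
  set E : ℝ → Matrix n n ℂ := fun s => NormedSpace.exp (-(β : ℂ) • (H + s • V)) with hE
  let T : Matrix n n ℂ →L[ℝ] ℝ :=
    Complex.reCLM.comp (LinearMap.toContinuousLinearMap ((Matrix.traceLinearMap n ℂ ℂ).restrictScalars ℝ))
  have hT : ∀ M, T M = M.trace.re := fun M => rfl
  have hTd : ∀ s, HasDerivAt (fun s => T (E s)) (-β * (E s * V).trace.re) s := fun s => by
    have h := T.hasFDerivAt.comp_hasDerivAt s (hasDerivAt_exp_hamiltonian β H V s)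
    refine h.congr_deriv ?_
    set c := -(β : ℂ) • (H + s • V) with hc
    have hcont : Continuous fun u : ℝ => NormedSpace.exp (u • c) * (-(β : ℂ) • V) *
        NormedSpace.exp ((1 - u) • c) := by
      have h1 := exp_smul_continuous (A := Matrix n n ℂ)
      exact ((h1.comp (by fun_prop : Continuous fun u : ℝ => (u, c))).mul
        continuous_const).mul (h1.comp (by fun_prop : Continuous fun u : ℝ => (1 - u, c)))
    rw [← T.intervalIntegral_comp_comm (hcont.intervalIntegrable _ _)]
    have hcst : ∀ u : ℝ, T (NormedSpace.exp (u • c) * (-(β : ℂ) • V) *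
        NormedSpace.exp ((1 - u) • c)) = -β * (E s * V).trace.re := fun u => by
      have e1 : NormedSpace.exp ((1 - u) • c) * NormedSpace.exp (u • c) = E s := by
        rw [← Matrix.exp_add_of_commute _ _
          (((Commute.refl c).smul_left _).smul_right _), ← add_smul]
        simp [hE, hc]
      rw [hT, Matrix.trace_mul_comm, ← mul_assoc, e1, Matrix.mul_smul, Matrix.trace_smul,
        smul_eq_mul, ← Complex.ofReal_neg, Complex.re_ofReal_mul]
    simp_rw [hcst]
    simp
  -- The function $e^{\beta\|V\|s}\,\mathrm{Tr}\,e^{-\beta(H+sV)}$ is nondecreasing, because the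
  -- logarithmic derivative of the trace is at least $-\beta\|V\|$.
  have hnn : ∀ s, 0 ≤ Real.exp (β * ‖V‖ * s) * (β * ‖V‖) * T (E s) +
      Real.exp (β * ‖V‖ * s) * (-β * (E s * V).trace.re) := fun s => by
    have h1 := norm_trace_mul_le_of_posSemidef
      (posDef_exp_smul β (isHermitian_add_real_smul hH hV s)).posSemidef V
    have h2 : (E s * V).trace.re ≤ T (E s) * ‖V‖ := (Complex.re_le_norm _).trans h1
    have h3 := Real.exp_pos (β * ‖V‖ * s)
    have : 0 ≤ Real.exp (β * ‖V‖ * s) * β * (T (E s) * ‖V‖ - (E s * V).trace.re) := by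
      have := sub_nonneg.2 h2
      positivity
    linarith
  have hd : ∀ s, HasDerivAt (fun s => Real.exp (β * ‖V‖ * s) * T (E s))
      (Real.exp (β * ‖V‖ * s) * (β * ‖V‖) * T (E s) +
        Real.exp (β * ‖V‖ * s) * (-β * (E s * V).trace.re)) s := fun s => by
    have h1 : HasDerivAt (fun s => Real.exp (β * ‖V‖ * s))
        (Real.exp (β * ‖V‖ * s) * (β * ‖V‖)) s := by
      simpa using ((hasDerivAt_id s).const_mul (β * ‖V‖)).exp
    exact h1.mul (hTd s)
  have hmono := monotone_of_deriv_nonneg (fun s => (hd s).differentiableAt)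
    (fun s => by rw [(hd s).deriv]; exact hnn s)
  have h := hmono zero_le_one
  simp only [mul_zero, Real.exp_zero, one_mul, mul_one, hT, hE, zero_smul, add_zero, one_smul] at h
  rw [Real.exp_neg, inv_mul_le_iff₀ (Real.exp_pos _)]
  exact h

theorem norm_star_mul_mul_sub_le {ξ ζ B : Matrix n n ℂ} {m δ : ℝ} (hξ : ‖ξ‖ ≤ m) (hζ : ‖ζ‖ ≤ m)
    (hδ : ‖ξ - ζ‖ ≤ δ) : ‖star ξ * B * ξ - star ζ * B * ζ‖ ≤ 2 * m * δ * ‖B‖ := by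
  have hm : 0 ≤ m := (norm_nonneg _).trans hξ
  have hδ0 : 0 ≤ δ := (norm_nonneg _).trans hδ
  have h : star ξ * B * ξ - star ζ * B * ζ = star (ξ - ζ) * B * ξ + star ζ * B * (ξ - ζ) := by
    rw [star_sub]; noncomm_ring
  rw [h]
  refine (norm_add_le _ _).trans ?_
  have h1 : ‖star (ξ - ζ) * B * ξ‖ ≤ δ * ‖B‖ * m := norm_mul₃_le.trans (by rw [norm_star]; gcongr)
  have h2 : ‖star ζ * B * (ξ - ζ)‖ ≤ m * ‖B‖ * δ := norm_mul₃_le.trans (by rw [norm_star]; gcongr)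
  linarith

/-- Change of the expectation of `B` under a perturbation `ρ ↦ ξ ρ ξ*` of the state, when `ξ` is
close to some `ζ` commuting with `B`. -/
theorem norm_trace_sub_perturbed_le {ρ ξ ζ B : Matrix n n ℂ}
    (hρ : ∀ M, ‖(ρ * M).trace‖ ≤ ‖M‖) {m δ L κ : ℝ} (hξ : ‖ξ‖ ≤ m) (hζ : ‖ζ‖ ≤ m)
    (hδ : ‖ξ - ζ‖ ≤ δ) (hB : B * ζ = ζ * B)
    (hcov : ‖(ρ * (star ζ * ζ) * B).trace - (ρ * (star ζ * ζ)).trace * (ρ * B).trace‖ ≤ κ)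
    (hL : Real.exp (-L) ≤ ‖(ξ * ρ * star ξ).trace‖) :
    ‖(ρ * B).trace - (ξ * ρ * star ξ).trace⁻¹ * (ξ * ρ * star ξ * B).trace‖ ≤
      Real.exp L * (κ + 4 * m * δ * ‖B‖) := by
  have hm : 0 ≤ m := (norm_nonneg _).trans hξ
  have hδ0 : 0 ≤ δ := (norm_nonneg _).trans hδ
  set w := (ξ * ρ * star ξ).trace with hw
  have hw0 : 0 < ‖w‖ := (Real.exp_pos _).trans_le hL
  have hwne : w ≠ 0 := norm_pos_iff.1 hw0
  have hw1 : w = (ρ * (star ξ * ξ)).trace := by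
    rw [hw, mul_assoc, Matrix.trace_mul_comm, mul_assoc]
  have hw2 : (ξ * ρ * star ξ * B).trace = (ρ * (star ξ * B * ξ)).trace := by
    rw [mul_assoc, mul_assoc, Matrix.trace_mul_comm]; simp only [mul_assoc]
  have h1 : ‖w - (ρ * (star ζ * ζ)).trace‖ ≤ 2 * m * δ := by
    rw [hw1, ← Matrix.trace_sub, ← mul_sub]
    refine (hρ _).trans ?_
    have e : star ξ * ξ - star ζ * ζ = star (ξ - ζ) * ξ + star ζ * (ξ - ζ) := by
      rw [star_sub]; noncomm_ring
    rw [e]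
    refine (norm_add_le _ _).trans ?_
    have h1 : ‖star (ξ - ζ) * ξ‖ ≤ δ * m := (norm_mul_le _ _).trans (by rw [norm_star]; gcongr)
    have h2 : ‖star ζ * (ξ - ζ)‖ ≤ m * δ := (norm_mul_le _ _).trans (by rw [norm_star]; gcongr)
    linarith
  have h2 : ‖(ρ * (star ζ * ζ) * B).trace - (ρ * (star ξ * B * ξ)).trace‖ ≤ 2 * m * δ * ‖B‖ := by
    have e : ρ * (star ζ * ζ) * B = ρ * (star ζ * B * ζ) := by
      rw [mul_assoc ρ, mul_assoc (star ζ), mul_assoc (star ζ), hB]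
    rw [e, ← Matrix.trace_sub, ← mul_sub, ← neg_sub, mul_neg, Matrix.trace_neg, norm_neg]
    exact (hρ _).trans (norm_star_mul_mul_sub_le hξ hζ hδ)
  -- Replacing $\xi$ by $\zeta$ in the normalization and in the numerator costs $2m\delta\|B\|$
  -- each; the covariance with $\zeta^*\zeta$ remains.
  have h3 : (ρ * B).trace - w⁻¹ * (ξ * ρ * star ξ * B).trace = w⁻¹ *
      ((w - (ρ * (star ζ * ζ)).trace) * (ρ * B).trace
        - ((ρ * (star ζ * ζ) * B).trace - (ρ * (star ζ * ζ)).trace * (ρ * B).trace)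
        + ((ρ * (star ζ * ζ) * B).trace - (ρ * (star ξ * B * ξ)).trace)) := by
    rw [hw2]; field_simp; ring
  rw [h3, norm_mul, norm_inv]
  have h4 : ‖w‖⁻¹ ≤ Real.exp L := by
    rw [inv_le_comm₀ hw0 (Real.exp_pos _), ← Real.exp_neg]; exact hL
  gcongr
  refine (norm_add_le _ _).trans ?_
  have h5 : ‖(w - (ρ * (star ζ * ζ)).trace) * (ρ * B).trace‖ ≤ 2 * m * δ * ‖B‖ := by
    rw [norm_mul]; gcongr; exact hρ B
  have h6 := norm_sub_le ((w - (ρ * (star ζ * ζ)).trace) * (ρ * B).trace)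
    ((ρ * (star ζ * ζ) * B).trace - (ρ * (star ζ * ζ)).trace * (ρ * B).trace)
  linarith

end Matrix

/-! ### Embeddings of local algebras and norms of products -/

section Embed

variable {D : ℕ} {X Y Λ : Finset ℤ}

/-- Restriction of configurations. -/
def restr (h : X ⊆ Λ) (σ : Λ → Fin D) : X → Fin D := fun x => σ ⟨x, h x.2⟩

/-- Replace the configuration `σ` inside `X` by `ω`. -/
def patch (σ : Λ → Fin D) (ω : X → Fin D) : Λ → Fin D :=
  fun x => if hx : (x : ℤ) ∈ X then ω ⟨x, hx⟩ else σ x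

theorem patch_of_mem (σ : Λ → Fin D) (ω : X → Fin D) {x : Λ} (hx : (x : ℤ) ∈ X) :
    patch σ ω x = ω ⟨x, hx⟩ := dif_pos hx

theorem patch_of_notMem (σ : Λ → Fin D) (ω : X → Fin D) {x : Λ} (hx : (x : ℤ) ∉ X) :
    patch σ ω x = σ x := dif_neg hx

@[simp]
theorem restr_patch (h : X ⊆ Λ) (σ : Λ → Fin D) (ω : X → Fin D) : restr h (patch σ ω) = ω := by
  funext x
  exact patch_of_mem σ ω x.2

theorem restr_patch_of_disjoint (h : Y ⊆ Λ) (hXY : Disjoint X Y) (σ : Λ → Fin D) (ω : X → Fin D) :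
    restr h (patch σ ω) = restr h σ := by
  funext x
  exact patch_of_notMem σ ω (Finset.disjoint_right.1 hXY x.2)

theorem embed_apply (h : X ⊆ Λ) (A : LocalAlgebra D X) (σ τ : Λ → Fin D) :
    embed h A σ τ = if ∀ x : Λ, (x : ℤ) ∉ X → σ x = τ x then A (restr h σ) (restr h τ) else 0 :=
  rfl

theorem sum_ite_agree (h : X ⊆ Λ) (σ : Λ → Fin D) (f : (Λ → Fin D) → ℂ) :
    (∑ κ, if ∀ x : Λ, (x : ℤ) ∉ X → σ x = κ x then f κ else 0) = ∑ ω : X → Fin D, f (patch σ ω) := by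
  rw [← Finset.sum_filter]
  refine Finset.sum_nbij' (fun κ => restr h κ) (fun ω => patch σ ω) (by simp) (fun ω _ => ?_)
    (fun κ hκ => ?_) (by simp) (fun κ hκ => ?_)
  · simp only [Finset.mem_filter, Finset.mem_univ, true_and]
    exact fun x hx => (patch_of_notMem σ ω hx).symm
  all_goals
    have e : patch σ (restr h κ) = κ := by
      funext x
      by_cases hx : (x : ℤ) ∈ X
      · rw [patch_of_mem _ _ hx]; rfl
      · rw [patch_of_notMem _ _ hx]; exact (Finset.mem_filter.1 hκ).2 x hx
    first | exact e | rw [e]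

theorem embed_mul_apply (h : X ⊆ Λ) (A : LocalAlgebra D X) (M : LocalAlgebra D Λ)
    (σ τ : Λ → Fin D) :
    (embed h A * M) σ τ = ∑ ω : X → Fin D, A (restr h σ) ω * M (patch σ ω) τ := by
  rw [Matrix.mul_apply]
  simp only [embed_apply, ite_mul, zero_mul]
  rw [sum_ite_agree h σ fun κ => A (restr h σ) (restr h κ) * M κ τ]
  simp

theorem embed_mul (h : X ⊆ Λ) (A B : LocalAlgebra D X) :
    embed h (A * B) = embed h A * embed h B := by
  ext σ τ
  rw [embed_mul_apply, embed_apply, Matrix.mul_apply]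
  have e : ∀ ω : X → Fin D, (∀ x : Λ, (x : ℤ) ∉ X → patch σ ω x = τ x) ↔
      ∀ x : Λ, (x : ℤ) ∉ X → σ x = τ x := fun ω =>
    forall₂_congr fun x hx => by rw [patch_of_notMem _ _ hx]
  simp only [embed_apply, e, restr_patch]
  split_ifs <;> simp

theorem embed_one (h : X ⊆ Λ) : embed h (1 : LocalAlgebra D X) = 1 := by
  ext σ τ
  rw [embed_apply, Matrix.one_apply, Matrix.one_apply]
  by_cases hστ : σ = τ
  · simp [hστ]
  · rw [if_neg hστ]
    split_ifs with h1 h2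
    · refine absurd (funext fun x => ?_) hστ
      by_cases hx : (x : ℤ) ∈ X
      · exact congrFun h2 ⟨x, hx⟩
      · exact h1 x hx
    all_goals rfl

theorem embed_conjTranspose (h : X ⊆ Λ) (A : LocalAlgebra D X) :
    embed h A.conjTranspose = (embed h A).conjTranspose := by
  ext σ τ
  rw [Matrix.conjTranspose_apply, embed_apply, embed_apply, Matrix.conjTranspose_apply]
  simp only [eq_comm (a := σ _)]
  split_ifs <;> simp

/-- `embed` as a homomorphism of `*`-algebras. -/
def embedHom (D : ℕ) (h : X ⊆ Λ) : LocalAlgebra D X →⋆ₐ[ℂ] LocalAlgebra D Λ where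
  toFun := embed h
  map_one' := embed_one h
  map_mul' := embed_mul h
  map_zero' := by ext σ τ; simp [embed_apply]
  map_add' A B := by
    ext σ τ
    simp only [embed_apply, Matrix.add_apply]
    split_ifs <;> simp
  commutes' c := by
    have : ∀ A : LocalAlgebra D X, embed h (c • A) = c • embed h A := fun A => by
      ext σ τ
      simp only [embed_apply, Matrix.smul_apply]
      split_ifs <;> simp
    rw [Algebra.algebraMap_eq_smul_one, Algebra.algebraMap_eq_smul_one, this, embed_one]
  map_star' := embed_conjTranspose h

theorem embedHom_apply (h : X ⊆ Λ) (A : LocalAlgebra D X) : embedHom D h A = embed h A := rfl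

theorem embed_embed (h : X ⊆ Y) (h' : Y ⊆ Λ) (A : LocalAlgebra D X) :
    embed h' (embed h A) = embed (h.trans h') A := by
  ext σ τ
  simp only [embed_apply]
  by_cases h1 : ∀ x : Λ, (x : ℤ) ∉ X → σ x = τ x
  · have h2 : ∀ x : Y, (x : ℤ) ∉ X → restr h' σ x = restr h' τ x :=
      fun x hx => h1 ⟨x, h' x.2⟩ hx
    rw [if_pos h1, if_pos fun x hx => h1 x fun hx' => hx (h hx'), if_pos h2]
    rfl
  · rw [if_neg h1]
    split_ifs with h2 h3
    · refine absurd (fun x hx => ?_) h1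
      by_cases hxY : (x : ℤ) ∈ Y
      · exact h3 ⟨x, hxY⟩ hx
      · exact h2 x hxY
    all_goals rfl

theorem embed_self (A : LocalAlgebra D X) : embed (Finset.Subset.refl X) A = A := by
  ext σ τ
  rw [embed_apply, if_pos (fun (x : X) hx => absurd x.2 hx)]; rfl

theorem embed_mul_embed_apply (hX : X ⊆ Λ) (hY : Y ⊆ Λ) (hXY : Disjoint X Y)
    (A : LocalAlgebra D X) (B : LocalAlgebra D Y) (σ τ : Λ → Fin D) :
    (embed hX A * embed hY B) σ τ =
      if ∀ x : Λ, (x : ℤ) ∉ X → (x : ℤ) ∉ Y → σ x = τ x then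
        A (restr hX σ) (restr hX τ) * B (restr hY σ) (restr hY τ) else 0 := by
  rw [embed_mul_apply, Finset.sum_eq_single (restr hX τ)]
  · rw [embed_apply, restr_patch_of_disjoint hY hXY, mul_ite, mul_zero]
    refine if_congr (forall_congr' fun x => ?_) rfl rfl
    by_cases hx : (x : ℤ) ∈ X
    · simp [hx, patch_of_mem, restr]
    · simp [hx, patch_of_notMem]
  · intro ω _ hω
    rw [embed_apply, if_neg, mul_zero]
    intro h
    refine hω (funext fun x => ?_)
    have := h ⟨x, hX x.2⟩ (Finset.disjoint_left.1 hXY x.2)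
    rw [patch_of_mem _ _ (by exact x.2)] at this
    exact this
  · simp

theorem embed_mul_embed_comm (hX : X ⊆ Λ) (hY : Y ⊆ Λ) (hXY : Disjoint X Y)
    (A : LocalAlgebra D X) (B : LocalAlgebra D Y) :
    embed hX A * embed hY B = embed hY B * embed hX A := by
  ext σ τ
  rw [embed_mul_embed_apply hX hY hXY, embed_mul_embed_apply hY hX hXY.symm]
  refine if_congr (forall_congr' fun x => ⟨fun h a b => h b a, fun h a b => h b a⟩) (mul_comm _ _) rfl

theorem embed_injective [NeZero D] (h : X ⊆ Λ) :
    Function.Injective (embed h : LocalAlgebra D X → LocalAlgebra D Λ) := by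
  intro A B hAB
  ext σ τ
  -- A common reference configuration outside $X$ makes the two arguments agree there; it exists
  -- because $D\ne0$.
  have := congrFun (congrFun hAB (patch 0 σ)) (patch 0 τ)
  rw [embed_apply, embed_apply, if_pos, if_pos, restr_patch, restr_patch] at this
  · exact this
  all_goals exact fun x hx => by rw [patch_of_notMem _ _ hx, patch_of_notMem _ _ hx]

theorem norm_embed [NeZero D] (h : X ⊆ Λ) (A : LocalAlgebra D X) : ‖embed h A‖ = ‖A‖ :=
  NonUnitalStarAlgHom.norm_map (embedHom D h) (embed_injective h) A

/-- The projection is onto an eigenvector whose eigenvalue has the largest modulus. -/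
theorem exists_eigenprojection {n : Type*} [Fintype n] [DecidableEq n] [Nonempty n]
    {b : Matrix n n ℂ} (hb : b.IsHermitian) :
    ∃ (P : Matrix n n ℂ) (e : ℝ), P ≠ 0 ∧ P * P = P ∧ star P = P ∧ |e| = ‖b‖ ∧
      b * P = (e : ℂ) • P := by
  obtain ⟨φ, e, he⟩ := exists_diagonalization hb
  obtain ⟨i, hi⟩ := Finite.exists_max fun i => ‖(e i : ℂ)‖
  have hnorm : ‖b‖ = |e i| := by
    rw [← StarAlgEquiv.norm_map φ b, he, Matrix.l2_opNorm_diagonal]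
    refine le_antisymm ((pi_norm_le_iff_of_nonneg (abs_nonneg _)).2 fun j => ?_) ?_
    · simpa using hi j
    · simpa using norm_le_pi_norm (fun i => (e i : ℂ)) i
  have hQ : ∀ Q, φ (φ.symm Q) = Q := fun Q => φ.apply_symm_apply Q
  refine ⟨φ.symm (Matrix.diagonal (Pi.single i 1)), e i, ?_, ?_, ?_, hnorm.symm, ?_⟩
  · intro h0
    have h1 := congrArg φ h0
    rw [hQ, map_zero, Matrix.diagonal_eq_zero] at h1
    simpa using congrFun h1 i
  · rw [← map_mul, Matrix.diagonal_mul_diagonal]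
    congr 2; funext j
    by_cases hj : j = i
    · subst hj; simp
    · simp [hj]
  · rw [← map_star, Matrix.star_eq_conjTranspose, Matrix.diagonal_conjTranspose]
    congr 2; funext j
    by_cases hj : j = i
    · subst hj; simp
    · simp [hj]
  · apply EquivLike.injective φ
    rw [map_mul, map_smul, hQ, he, Matrix.diagonal_mul_diagonal, ← Matrix.diagonal_smul]
    congr 1; funext j
    by_cases hj : j = i
    · subst hj; simp
    · simp [hj]

/-- The map $A\mapsto A\otimes P$ is an injective, in general non-unital, *-homomorphism and
therefore isometric. Injectivity is read off at a nonzero entry of $P$. -/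
theorem norm_embed_mul_projection [NeZero D] (hX : X ⊆ Λ) (hY : Y ⊆ Λ) (hXY : Disjoint X Y)
    (A : LocalAlgebra D X) {P : LocalAlgebra D Y} (hP0 : P ≠ 0) (hPP : P * P = P)
    (hPs : star P = P) : ‖embed hX A * embed hY P‖ = ‖A‖ := by
  have hc := fun A : LocalAlgebra D X => embed_mul_embed_comm hX hY hXY A P
  have hPP' : embed hY P * embed hY P = embed hY P := by rw [← embed_mul, hPP]
  let φ : LocalAlgebra D X →⋆ₙₐ[ℂ] LocalAlgebra D Λ :=
    { toFun := fun A => embed hX A * embed hY P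
      map_smul' := fun c A => by
        simp only [← embedHom_apply, map_smul, smul_mul_assoc, MonoidHom.id_apply]
      map_zero' := by simp only [← embedHom_apply, map_zero, zero_mul]
      map_add' := fun A B => by simp only [← embedHom_apply, map_add, add_mul]
      map_mul' := fun A B => by
        rw [embed_mul, mul_assoc (embed hX A) (embed hY P), ← mul_assoc (embed hY P), ← hc B,
          mul_assoc (embed hX B), hPP', ← mul_assoc]
      map_star' := fun A => by
        rw [StarMul.star_mul, ← embedHom_apply hX A, ← embedHom_apply hY P, ← map_star, ← map_star,
          hPs, embedHom_apply, embedHom_apply, ← hc] }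
  refine NonUnitalStarAlgHom.norm_map φ ((injective_iff_map_eq_zero φ).2 fun A hA => ?_) A
  obtain ⟨μ, ν, hμν⟩ : ∃ μ ν, P μ ν ≠ 0 := by
    by_contra! h
    exact hP0 (Matrix.ext h)
  ext σ τ
  have := congrFun (congrFun hA (patch (patch 0 σ) μ)) (patch (patch 0 τ) ν)
  change (embed hX A * embed hY P) _ _ = 0 at this
  rw [embed_mul_embed_apply hX hY hXY, if_pos, restr_patch_of_disjoint hX hXY.symm,
    restr_patch_of_disjoint hX hXY.symm, restr_patch, restr_patch, restr_patch, restr_patch] at this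
  · exact (mul_eq_zero.1 this).resolve_right hμν
  · intro x hx hy
    rw [patch_of_notMem _ _ hy, patch_of_notMem _ _ hx, patch_of_notMem _ _ hy,
      patch_of_notMem _ _ hx]

/-- The operator norm is multiplicative on products of observables with disjoint supports. -/
theorem norm_mul_norm_le_norm_embed_mul_embed [NeZero D] (hX : X ⊆ Λ) (hY : Y ⊆ Λ)
    (hXY : Disjoint X Y) (A : LocalAlgebra D X) (B : LocalAlgebra D Y) :
    ‖A‖ * ‖B‖ ≤ ‖embed hX A * embed hY B‖ := by
  obtain ⟨P, e, hP0, hPP, hPs, he, hbP⟩ := exists_eigenprojection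
    (Matrix.isHermitian_conjTranspose_mul_self B)
  set T := embed hX A * embed hY B with hT
  have hPn : ‖P‖ ≤ 1 := by
    have h1 : ‖P‖ * ‖P‖ = ‖P‖ := by
      rw [← CStarRing.norm_star_mul_self, hPs, hPP]
    have h2 : 0 < ‖P‖ := norm_pos_iff.2 hP0
    nlinarith
  -- Compressing to the top eigenvector of $B^*B$ turns $T^*T$ into $\|B\|^2\,A^*A\otimes P$, whose
  -- norm is known exactly.
  have h1 : star T * T * embed hY P =
      (e : ℂ) • (embed hX (star A * A) * embed hY P) := by
    have hs : star T = embed hX (star A) * embed hY (star B) := by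
      rw [hT, StarMul.star_mul, ← embedHom_apply hX A, ← embedHom_apply hY B, ← map_star, ← map_star,
        embedHom_apply, embedHom_apply, embed_mul_embed_comm hX hY hXY]
    calc star T * T * embed hY P
        = embed hX (star A) * (embed hY (star B) * embed hX A) * embed hY B * embed hY P := by
          rw [hs, hT]; simp only [mul_assoc]
      _ = (embed hX (star A) * embed hX A) * (embed hY (star B) * embed hY B * embed hY P) := by
          rw [← embed_mul_embed_comm hX hY hXY A (star B)]; simp only [mul_assoc]
      _ = embed hX (star A * A) * embed hY ((e : ℂ) • P) := by
          rw [← embed_mul, ← embed_mul, ← embed_mul, Matrix.star_eq_conjTranspose B, hbP]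
      _ = _ := by
          rw [← embedHom_apply hY, map_smul, embedHom_apply, mul_smul_comm]
  have h2 : (‖A‖ * ‖B‖) * (‖A‖ * ‖B‖) ≤ ‖T‖ * ‖T‖ := by
    calc (‖A‖ * ‖B‖) * (‖A‖ * ‖B‖) = (‖B‖ * ‖B‖) * (‖A‖ * ‖A‖) := by ring
      _ = |e| * ‖star A * A‖ := by
          rw [he, Matrix.l2_opNorm_conjTranspose_mul_self, CStarRing.norm_star_mul_self]
      _ = ‖star T * T * embed hY P‖ := by
          rw [h1, norm_smul, norm_embed_mul_projection hX hY hXY _ hP0 hPP hPs, Complex.norm_real,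
            Real.norm_eq_abs]
      _ ≤ ‖star T * T‖ * ‖embed hY P‖ := norm_mul_le _ _
      _ ≤ ‖star T * T‖ * 1 := by
          rw [norm_embed]; gcongr
      _ = ‖T‖ * ‖T‖ := by rw [mul_one, CStarRing.norm_star_mul_self]
  have h3 : 0 ≤ ‖T‖ := norm_nonneg T
  have h4 : 0 ≤ ‖A‖ * ‖B‖ := mul_nonneg (norm_nonneg A) (norm_nonneg B)
  revert h2 h3 h4
  generalize ‖T‖ = t, ‖A‖ * ‖B‖ = a
  exact fun h2 h3 h4 => (mul_self_le_mul_self_iff h4 h3).2 h2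

end Embed

/-! ### Interactions and their local Hamiltonians -/

section Interaction

variable {D : ℕ}

/-- The interaction term of `Z`, as an observable on `I` (zero if `Z` is not contained in `I`). -/
def Interaction.termIn (Ψ : Interaction D) (I Z : Finset ℤ) : LocalAlgebra D I :=
  if h : Z ⊆ I then embed h (Ψ.term Z) else 0

theorem Interaction.embed_hamiltonian (Ψ : Interaction D) {Λ I : Finset ℤ} (h : Λ ⊆ I) :
    embed h (Ψ.hamiltonian Λ) = ∑ Z ∈ Λ.powerset, Ψ.termIn I Z := by
  rw [Interaction.hamiltonian, ← embedHom_apply, map_sum, ← Finset.sum_attach Λ.powerset]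
  refine Finset.sum_congr rfl fun Z _ => ?_
  rw [embedHom_apply, embed_embed, Interaction.termIn, dif_pos]

theorem Interaction.hamiltonian_eq_sum (Ψ : Interaction D) (I : Finset ℤ) :
    Ψ.hamiltonian I = ∑ Z ∈ I.powerset, Ψ.termIn I Z := by
  rw [← Ψ.embed_hamiltonian (Finset.Subset.refl I), embed_self]

theorem embed_add_real_smul {X Λ : Finset ℤ} (h : X ⊆ Λ) (A B : LocalAlgebra D X) (s : ℝ) :
    embed h (A + s • B) = embed h A + s • embed h B := by
  ext σ τ
  simp only [embed_apply, Matrix.add_apply, Matrix.smul_apply]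
  split_ifs <;> simp

theorem isHermitian_embed {X Λ : Finset ℤ} (h : X ⊆ Λ) {A : LocalAlgebra D X} (hA : A.IsHermitian) :
    (embed h A).IsHermitian := by
  rw [Matrix.IsHermitian, ← embed_conjTranspose, hA.eq]

theorem Interaction.isHermitian_hamiltonian (Ψ : Interaction D) (Λ : Finset ℤ) :
    (Ψ.hamiltonian Λ).IsHermitian :=
  isSelfAdjoint_sum _ fun X _ => isHermitian_embed _ (Ψ.selfAdjoint X.1)

theorem Interaction.norm_termIn_le [NeZero D] (Ψ : Interaction D) (I Z : Finset ℤ) :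
    ‖Ψ.termIn I Z‖ ≤ ‖Ψ.term Z‖ := by
  rw [Interaction.termIn]
  split_ifs with h
  · exact (norm_embed h _).le
  · simp

/-- The terms through one site with diameter at least $m$ pay $e^{-bm}$ of the weight in the
interaction norm; the factor $|Z|\ge1$ is discarded. -/
theorem Interaction.sum_norm_term_le {Ψ : Interaction D} {b C : ℝ} (hb : 0 < b) (hC : 0 ≤ C)
    (hΨ : Ψ.eNorm b ≤ ENNReal.ofReal C) (S : Finset (Finset ℤ)) (z : ℤ) (m : ℝ)
    (hS : ∀ Z ∈ S, z ∈ Z ∧ m ≤ Metric.diam (Z : Set ℤ)) :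
    ∑ Z ∈ S, ‖Ψ.term Z‖ ≤ C * Real.exp (-b * m) := by
  classical
  set f : Finset ℤ → ℝ := fun Z =>
    (Z.card : ℝ) * ‖Ψ.term Z‖ / Real.exp (-b * Metric.diam (Z : Set ℤ)) with hf
  have hf0 : ∀ Z, 0 ≤ f Z := fun Z => by positivity
  have h1 : ∑ Z ∈ S, f Z ≤ C := by
    rw [← ENNReal.ofReal_le_ofReal_iff hC, ENNReal.ofReal_sum_of_nonneg fun Z _ => hf0 Z]
    refine le_trans ?_ ((le_iSup (fun z : ℤ => ∑' Z : {Z : Finset ℤ // z ∈ Z},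
      ENNReal.ofReal (f Z.1)) z).trans hΨ)
    refine le_trans (le_of_eq ?_) (ENNReal.sum_le_tsum (S.subtype (z ∈ ·)))
    rw [Finset.sum_subtype_eq_sum_filter (f := fun Z => ENNReal.ofReal (f Z)),
      Finset.filter_true_of_mem fun Z hZ => (hS Z hZ).1]
  have h2 : ∀ Z ∈ S, ‖Ψ.term Z‖ ≤ f Z * Real.exp (-b * m) := fun Z hZ => by
    have hcard : (1 : ℝ) ≤ Z.card := by
      exact_mod_cast Finset.card_pos.2 ⟨z, (hS Z hZ).1⟩
    have hexp : Real.exp (-b * Metric.diam (Z : Set ℤ)) ≤ Real.exp (-b * m) :=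
      Real.exp_le_exp.2 (by nlinarith [(hS Z hZ).2])
    calc ‖Ψ.term Z‖ ≤ Z.card * ‖Ψ.term Z‖ := le_mul_of_one_le_left (norm_nonneg _) hcard
      _ = f Z * Real.exp (-b * Metric.diam (Z : Set ℤ)) := by
          rw [hf]; field_simp
      _ ≤ f Z * Real.exp (-b * m) := mul_le_mul_of_nonneg_left hexp (hf0 Z)
  calc ∑ Z ∈ S, ‖Ψ.term Z‖ ≤ ∑ Z ∈ S, f Z * Real.exp (-b * m) := Finset.sum_le_sum h2
    _ = (∑ Z ∈ S, f Z) * Real.exp (-b * m) := by rw [Finset.sum_mul]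
    _ ≤ _ := by gcongr

end Interaction

/-! ### Growing windows around the perturbation -/

section Window

/-- The sites of `I` at distance at most `n` from `[p, q]`. -/
def window (I : Finset ℤ) (p q : ℤ) (n : ℕ) : Finset ℤ :=
  I.filter fun z => p - n ≤ z ∧ z ≤ q + n

theorem window_subset (I : Finset ℤ) (p q : ℤ) (n : ℕ) : window I p q n ⊆ I :=
  Finset.filter_subset _ _

theorem mem_window {I : Finset ℤ} {p q : ℤ} {n : ℕ} {z : ℤ} :
    z ∈ window I p q n ↔ z ∈ I ∧ p - n ≤ z ∧ z ≤ q + n := Finset.mem_filter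

theorem window_mono (I : Finset ℤ) (p q : ℤ) : Monotone (window I p q) := fun m n hmn z hz => by
  rw [mem_window] at hz ⊢
  exact ⟨hz.1, by lia, by lia⟩

theorem exists_window_eq (I : Finset ℤ) (p q : ℤ) (r : ℕ) : ∃ m, window I p q (r + m) = I := by
  obtain ⟨m, hm⟩ : ∃ m : ℕ, ∀ z ∈ I, (z - p).natAbs + (z - q).natAbs ≤ m :=
    ⟨I.sup fun z => (z - p).natAbs + (z - q).natAbs, fun z hz =>
      Finset.le_sup (f := fun z : ℤ => (z - p).natAbs + (z - q).natAbs) hz⟩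
  refine ⟨m, Finset.filter_true_of_mem fun z hz => ?_⟩
  have := hm z hz
  constructor <;> push_cast <;> lia

variable {D : ℕ}

/-- The increments of the Hamiltonians of growing windows almost commute with the observables
of the inner windows. -/
theorem norm_window_increment_comm_le [NeZero D] {Ψ : Interaction D} {b C : ℝ} (hb : 0 < b)
    (hC : 0 ≤ C) (hΨ : Ψ.eNorm b ≤ ENNReal.ofReal C) (I : Finset ℤ) (p q : ℤ) {n k : ℕ}
    (hkn : k ≤ n) (A : LocalAlgebra D (window I p q k)) :
    let w := ∑ Z ∈ (window I p q (n + 1)).powerset, Ψ.termIn I Z -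
      ∑ Z ∈ (window I p q n).powerset, Ψ.termIn I Z
    let M := embed (window_subset I p q k) A
    ‖w * M - M * w‖ ≤ 4 * C * Real.exp (-b / 2) ^ (2 * (n + 1 - k)) * ‖M‖ := by
  classical
  intro w M
  set S := (window I p q (n + 1)).powerset \ (window I p q n).powerset with hS
  have hw : w = ∑ Z ∈ S, Ψ.termIn I Z := by
    rw [hS, Finset.sum_sdiff_eq_sub
      (Finset.powerset_mono.2 (window_mono I p q (Nat.le_succ n)))]
  set T := S.filter fun Z => ¬ Disjoint Z (window I p q k) with hT
  have hcomm : ∀ Z ∈ S, Z ∉ T → Ψ.termIn I Z * M - M * Ψ.termIn I Z = 0 := fun Z hZ hZT => by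
    have hd : Disjoint Z (window I p q k) := by
      by_contra h
      exact hZT (Finset.mem_filter.2 ⟨hZ, h⟩)
    rw [Interaction.termIn]
    split_ifs with h
    · rw [embed_mul_embed_comm _ _ hd, sub_self]
    · simp
  have hsum : w * M - M * w = ∑ Z ∈ T, (Ψ.termIn I Z * M - M * Ψ.termIn I Z) := by
    rw [hw, Finset.sum_mul, Finset.mul_sum, ← Finset.sum_sub_distrib]
    exact (Finset.sum_subset (Finset.filter_subset _ _) hcomm).symm
  -- One-dimensionality: a window grows by at most two sites, so a new term contains one of them. If
  -- it also meets the window of radius $k$, its diameter is at least $n+1-k$. The two sites and the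
  -- two halves of the commutator give the constant $4C$.
  have hdist : ∀ Z ∈ T, (p - (n + 1 : ℕ) ∈ Z ∨ q + (n + 1 : ℕ) ∈ Z) ∧
      ((n + 1 - k : ℕ) : ℝ) ≤ Metric.diam (Z : Set ℤ) := fun Z hZ => by
    obtain ⟨hZS, hZd⟩ := Finset.mem_filter.1 hZ
    rw [hS, Finset.mem_sdiff, Finset.mem_powerset, Finset.mem_powerset] at hZS
    obtain ⟨x, hxZ, hxn⟩ := Finset.not_subset.1 hZS.2
    obtain ⟨y, hyZ, hyk⟩ := Finset.not_disjoint_iff.1 hZd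
    have hx := mem_window.1 (hZS.1 hxZ)
    rw [mem_window] at hxn hyk
    have hx' : x = p - (n + 1 : ℕ) ∨ x = q + (n + 1 : ℕ) := by
      have h1 : ¬ (p - n ≤ x ∧ x ≤ q + n) := fun h => hxn ⟨hx.1, h⟩
      push_cast at hx ⊢
      lia
    refine ⟨by rcases hx' with h | h <;> rw [← h] <;> simp [hxZ], ?_⟩
    refine le_trans ?_ (Metric.dist_le_diam_of_mem (Z.finite_toSet.isBounded)
      (Finset.mem_coe.2 hxZ) (Finset.mem_coe.2 hyZ))
    rw [Int.dist_eq, ← Int.cast_sub, ← Int.cast_abs]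
    have : ((n + 1 - k : ℕ) : ℤ) ≤ |x - y| := by
      rw [Nat.cast_sub (by lia)]
      rcases hx' with h | h <;> push_cast at h ⊢ <;>
        rcases abs_cases (x - y) with h' | h' <;> lia
    exact_mod_cast this
  have hside : ∀ z : ℤ, ∑ Z ∈ T.filter (z ∈ ·), ‖Ψ.term Z‖ ≤
      C * Real.exp (-b * (n + 1 - k : ℕ)) := fun z =>
    Interaction.sum_norm_term_le hb hC hΨ _ z _ fun Z hZ => by
      have hZ' := Finset.mem_filter.1 hZ
      exact ⟨hZ'.2, (hdist Z hZ'.1).2⟩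
  have hle : ∑ Z ∈ T, ‖Ψ.term Z‖ ≤ 2 * (C * Real.exp (-b * (n + 1 - k : ℕ))) := by
    calc ∑ Z ∈ T, ‖Ψ.term Z‖
        ≤ ∑ Z ∈ T.filter (p - (n + 1 : ℕ) ∈ ·) ∪ T.filter (q + (n + 1 : ℕ) ∈ ·), ‖Ψ.term Z‖ := by
          refine Finset.sum_le_sum_of_subset_of_nonneg (fun Z hZ => ?_) fun _ _ _ => norm_nonneg _
          rw [Finset.mem_union, Finset.mem_filter (s := T), Finset.mem_filter (s := T)]
          exact (hdist Z hZ).1.imp (fun h => ⟨hZ, h⟩) fun h => ⟨hZ, h⟩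
      _ ≤ ∑ Z ∈ T.filter (p - (n + 1 : ℕ) ∈ ·), ‖Ψ.term Z‖ +
            ∑ Z ∈ T.filter (q + (n + 1 : ℕ) ∈ ·), ‖Ψ.term Z‖ := by
          rw [← Finset.sum_union_inter]
          exact le_add_of_nonneg_right (Finset.sum_nonneg fun _ _ => norm_nonneg _)
      _ ≤ C * Real.exp (-b * (n + 1 - k : ℕ)) + C * Real.exp (-b * (n + 1 - k : ℕ)) := by
          exact add_le_add (hside _) (hside _)
      _ = _ := by ring
  have hpow : Real.exp (-b / 2) ^ (2 * (n + 1 - k)) = Real.exp (-b * (n + 1 - k : ℕ)) := by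
    rw [← Real.exp_nat_mul]; congr 1; push_cast; ring
  rw [hsum, hpow]
  refine (norm_sum_le _ _).trans ?_
  calc ∑ Z ∈ T, ‖Ψ.termIn I Z * M - M * Ψ.termIn I Z‖
      ≤ ∑ Z ∈ T, ‖Ψ.term Z‖ * (2 * ‖M‖) := by
        refine Finset.sum_le_sum fun Z _ => ?_
        have h0 := Ψ.norm_termIn_le I Z
        have h1 : ‖Ψ.termIn I Z * M‖ ≤ ‖Ψ.term Z‖ * ‖M‖ := (norm_mul_le _ _).trans (by gcongr)
        have h2 : ‖M * Ψ.termIn I Z‖ ≤ ‖M‖ * ‖Ψ.term Z‖ := (norm_mul_le _ _).trans (by gcongr)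
        linarith [norm_sub_le (Ψ.termIn I Z * M) (M * Ψ.termIn I Z)]
    _ = (∑ Z ∈ T, ‖Ψ.term Z‖) * (2 * ‖M‖) := by rw [Finset.sum_mul]
    _ ≤ 2 * (C * Real.exp (-b * (n + 1 - k : ℕ))) * (2 * ‖M‖) := by gcongr
    _ = _ := by ring

end Window

/-! ### Quasi-locality of the intertwiner -/

section Intertwiner

variable {D : ℕ}

/-- The constant in the quasi-locality estimate for the intertwiner of two Gibbs weights. -/
noncomputable def localityConst (b C β : ℝ) : ℝ :=
  3 / (2 * β) * (∫ s, ‖gaussKernel β s‖ *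
    (|s| * Real.exp (4 * C / (1 - Real.exp (-b / 2)) * |s|))) / (1 - Real.exp (-b / 2))

/-- Telescoping over windows: each step is the Lieb–Robinson bound integrated against the Gaussian.
The error is written in units of $\frac23\beta\|V\|$, the bound on the generator, as the Gronwall
comparison requires. -/
theorem norm_qbpGenerator_window_sub_le [NeZero D] {Ψ : Interaction D} {b C β : ℝ} (hb : 0 < b)
    (hC : 0 ≤ C) (hβ : 0 < β) (hΨ : Ψ.eNorm b ≤ ENNReal.ofReal C) {I X : Finset ℤ} {p q : ℤ}
    (hX : ∀ n, X ⊆ window I p q n) {V : LocalAlgebra D X} (hV : V.IsHermitian) (s : ℝ) (r m : ℕ) :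
    let h : ℕ → LocalAlgebra D I := fun n => embed (window_subset I p q n)
      (Ψ.hamiltonian (window I p q n) + s • embed (hX n) V)
    let V' := embed ((hX 0).trans (window_subset I p q 0)) V
    ‖qbpGenerator β (h (r + m)) V' - qbpGenerator β (h r) V'‖ ≤
      2 / 3 * β * ‖V‖ * (localityConst b C β * Real.exp (-b / 2) ^ r) := by
  intro h V'
  set t := Real.exp (-b / 2) with ht
  have ht0 : 0 < t := Real.exp_pos _
  have ht1 : t < 1 := (Real.exp_lt_exp.2 (by linarith)).trans_eq Real.exp_zero
  set J := ∫ s, ‖gaussKernel β s‖ * (|s| * Real.exp (4 * C / (1 - t) * |s|)) with hJ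
  have hJ0 : 0 ≤ J := MeasureTheory.integral_nonneg fun s => by positivity
  have ht' : 0 < 1 - t := by linarith
  have hh : ∀ n, IsSelfAdjoint (h n) := fun n =>
    isHermitian_embed _ (isHermitian_add_real_smul (Ψ.isHermitian_hamiltonian _)
      (isHermitian_embed _ hV) s)
  have hVn : ∀ n, V' = embed (window_subset I p q n) (embed (hX n) V) := fun n => by
    rw [embed_embed]
  have hdecomp : ∀ n, h n = ∑ Z ∈ (window I p q n).powerset, Ψ.termIn I Z + s • V' := fun n => by
    change embed _ _ = _
    rw [embed_add_real_smul, Ψ.embed_hamiltonian, ← hVn]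
  let S : ℕ → AddSubgroup (LocalAlgebra D I) := fun n =>
    (AddMonoidHomClass.toAddMonoidHom (embedHom D (window_subset I p q n))).range
  have hS : Monotone S := fun m n hmn _ ⟨A, hA⟩ =>
    ⟨embed (window_mono I p q hmn) A, (embed_embed _ (window_subset I p q n) _).trans hA⟩
  have hmem : ∀ n t, evol (h n) t V' ∈ S n := fun n t =>
    ⟨evol (Ψ.hamiltonian (window I p q n) + s • embed (hX n) V) t (embed (hX n) V), by
      rw [hVn n]; exact map_evol (embedHom D (window_subset I p q n)) _ _ _⟩
  have hstep : ∀ n, ‖qbpGenerator β (h (n + 1)) V' - qbpGenerator β (h n) V'‖ ≤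
      ‖V‖ * t ^ (n + 1) * J := fun n => by
    refine norm_qbpGenerator_sub_le hβ (hh _) (hh _) V' (v := 4 * C / (1 - t)) (by positivity)
      fun u => ?_
    have := norm_evol_succ_sub_le hh hS hmem (K := 4 * C) (q := t) (by positivity) ht0 ht1
      (fun n k hk M hM => by
        obtain ⟨A, rfl⟩ := hM
        have := norm_window_increment_comm_le hb hC hΨ I p q hk A
        -- The perturbation $sV$ cancels in the increment, so neither the velocity nor the constants
        -- see $\|V\|$.
        rw [hdecomp, hdecomp, add_sub_add_right_eq_sub]
        exact this) n u
    rw [norm_embed] at this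
    linarith
  have hind : ∀ m, ‖qbpGenerator β (h (r + m)) V' - qbpGenerator β (h r) V'‖ ≤
      ‖V‖ * J * ((t ^ r - t ^ (r + m)) / (1 - t)) := fun m => by
    induction m with
    | zero => simp
    | succ m ih =>
      have h1 : t ^ (r + m + 1) ≤ t ^ (r + m) := pow_le_pow_of_le_one ht0.le ht1.le (Nat.le_succ _)
      have h2 : (t ^ r - t ^ (r + m + 1)) / (1 - t) = (t ^ r - t ^ (r + m)) / (1 - t) + t ^ (r + m) := by
        field_simp; ring
      have h3 := norm_add_le (qbpGenerator β (h (r + m + 1)) V' - qbpGenerator β (h (r + m)) V')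
        (qbpGenerator β (h (r + m)) V' - qbpGenerator β (h r) V')
      rw [sub_add_sub_cancel] at h3
      have h4 : ‖V‖ * t ^ (r + m + 1) * J ≤ ‖V‖ * t ^ (r + m) * J := by gcongr
      rw [← add_assoc, h2]
      linarith [hstep (r + m)]
  refine (hind m).trans ?_
  have h1 : 2 / 3 * β * ‖V‖ * (localityConst b C β * t ^ r) = ‖V‖ * J * (t ^ r / (1 - t)) := by
    rw [localityConst, ← ht, ← hJ]; field_simp
  rw [h1]
  gcongr
  linarith [pow_pos ht0 (r + m)]

/-- The Gibbs weights of `H_I` and `H_I + V` are intertwined by an operator which is local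
around the support of `V`, up to an exponentially small error. -/
theorem exists_local_intertwiner [NeZero D] {Ψ : Interaction D} {b C β : ℝ} (hb : 0 < b)
    (hC : 0 ≤ C) (hβ : 0 < β) (hΨ : Ψ.eNorm b ≤ ENNReal.ofReal C) {I X : Finset ℤ} {p q : ℤ}
    (hX : ∀ n, X ⊆ window I p q n) {V : LocalAlgebra D X} (hV : V.IsHermitian) (hV0 : V ≠ 0)
    (r : ℕ) :
    ∃ (ξ : LocalAlgebra D I) (ζ : LocalAlgebra D (window I p q r)),
      NormedSpace.exp (-(β : ℂ) • (Ψ.hamiltonian I +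
          embed ((hX 0).trans (window_subset I p q 0)) V)) =
        ξ * NormedSpace.exp (-(β : ℂ) • Ψ.hamiltonian I) * star ξ ∧
      ‖ξ‖ ≤ Real.exp (2 / 3 * β * ‖V‖) ∧ ‖ζ‖ ≤ Real.exp (2 / 3 * β * ‖V‖) ∧
      ‖ξ - embed (window_subset I p q r) ζ‖ ≤
        localityConst b C β * Real.exp (-b / 2) ^ r * Real.exp (2 * (2 / 3 * β * ‖V‖)) := by
  have hVpos : 0 < ‖V‖ := norm_pos_iff.2 hV0
  set V' := embed ((hX 0).trans (window_subset I p q 0)) V with hV'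
  have hV'h : V'.IsHermitian := isHermitian_embed _ hV
  have hV'n : ‖V'‖ = ‖V‖ := norm_embed _ _
  have hHI := Ψ.isHermitian_hamiltonian I
  have hbig : ∀ s : ℝ, IsSelfAdjoint (Ψ.hamiltonian I + (1 - s) • V') := fun s =>
    isHermitian_add_real_smul hHI hV'h _
  have hsmall : ∀ s : ℝ,
      IsSelfAdjoint (Ψ.hamiltonian (window I p q r) + (1 - s) • embed (hX r) V) := fun s =>
    isHermitian_add_real_smul (Ψ.isHermitian_hamiltonian _) (isHermitian_embed _ hV) _
  have hM1 : ∀ s : ℝ, ‖qbpGenerator β (Ψ.hamiltonian I + (1 - s) • V') V'‖ ≤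
      2 / 3 * β * ‖V‖ := fun s => by
    rw [← hV'n]; exact norm_qbpGenerator_le hβ (hbig s) V'
  have hM2 : ∀ s : ℝ, ‖qbpGenerator β (Ψ.hamiltonian (window I p q r) +
      (1 - s) • embed (hX r) V) (embed (hX r) V)‖ ≤ 2 / 3 * β * ‖V‖ := fun s => by
    rw [← norm_embed (hX r) V]; exact norm_qbpGenerator_le hβ (hsmall s) _
  obtain ⟨ξ, hξ0, hξ, hξM⟩ := exists_linear_ode_solution
    (continuous_qbpGenerator hβ hbig (by fun_prop) V') hM1
  -- The equation is solved inside the algebra of the window, so $\zeta$ is exactly local.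
  obtain ⟨ζ, hζ0, hζ, hζM⟩ := exists_linear_ode_solution
    (continuous_qbpGenerator hβ hsmall (by fun_prop) (embed (hX r) V)) hM2
  refine ⟨ξ 1, ζ 1, exp_hamiltonian_add_eq hβ hHI hV'h hξ0 hξ, by simpa using hξM 1,
    by simpa using hζM 1, ?_⟩
  let φ := embedHom D (window_subset I p q r)
  let L : LocalAlgebra D (window I p q r) →L[ℝ] LocalAlgebra D I :=
    (starHomCLM φ).restrictScalars ℝ
  refine norm_linear_ode_sub_le (ξ := ξ) (ζ := fun s => embed (window_subset I p q r) (ζ s))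
    (G := fun s => embed (window_subset I p q r) (qbpGenerator β (Ψ.hamiltonian (window I p q r) +
      (1 - s) • embed (hX r) V) (embed (hX r) V))) (by positivity) ?_ hξ (fun s => ?_) hM1
    (fun s => by rw [norm_embed]; exact hζM s) (fun s => ?_)
  · rw [hξ0, hζ0, embed_one]
  · rw [← embed_mul]
    exact L.hasFDerivAt.comp_hasDerivAt s (hζ s)
  -- The full interval $I$ is itself a sufficiently large window, so the generator of $I$ is the
  -- last one of the telescoping sequence.
  · obtain ⟨m, hm⟩ := exists_window_eq I p q r
    have key := norm_qbpGenerator_window_sub_le hb hC hβ hΨ hX hV (1 - s) r m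
    have e1 : embed (window_subset I p q (r + m)) (Ψ.hamiltonian (window I p q (r + m)) +
        (1 - s) • embed (hX (r + m)) V) = Ψ.hamiltonian I + (1 - s) • V' := by
      have e0 : ∑ Z ∈ (window I p q (r + m)).powerset, Ψ.termIn I Z = Ψ.hamiltonian I := by
        rw [hm, ← Ψ.hamiltonian_eq_sum]
      rw [embed_add_real_smul, embed_embed, Ψ.embed_hamiltonian, e0]
    have e2 : qbpGenerator β (embed (window_subset I p q r) (Ψ.hamiltonian (window I p q r) +
        (1 - s) • embed (hX r) V)) V' = embed (window_subset I p q r)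
        (qbpGenerator β (Ψ.hamiltonian (window I p q r) +
          (1 - s) • embed (hX r) V) (embed (hX r) V)) := by
      have := map_qbpGenerator φ hβ (hsmall s) (embed (hX r) V)
      have e3 : V' = φ (embed (hX r) V) := (embed_embed _ (window_subset I p q r) _).symm
      rw [e3]; exact this.symm
    simp only [e1, e2, ← hV'] at key
    exact key

end Intertwiner

/-! ### Gibbs states -/

section Gibbs

variable {D : ℕ} {Λ : Finset ℤ}

theorem trace_exp_pos [NeZero D] (β : ℝ) {H : LocalAlgebra D Λ} (hH : H.IsHermitian) :
    0 < (NormedSpace.exp (-(β : ℂ) • H)).trace.re ∧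
      (NormedSpace.exp (-(β : ℂ) • H)).trace =
        ((NormedSpace.exp (-(β : ℂ) • H)).trace.re : ℂ) := by
  have h := Complex.pos_iff.1 (posDef_exp_smul β hH).trace_pos
  exact ⟨h.1, Complex.ext rfl (by simpa using h.2.symm)⟩

theorem trace_exp_ne_zero [NeZero D] (β : ℝ) {H : LocalAlgebra D Λ} (hH : H.IsHermitian) :
    (NormedSpace.exp (-(β : ℂ) • H)).trace ≠ 0 := by
  rw [(trace_exp_pos β hH).2]
  exact_mod_cast (trace_exp_pos β hH).1.ne'

theorem trace_gibbs [NeZero D] (β : ℝ) {H : LocalAlgebra D Λ} (hH : H.IsHermitian) :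
    (gibbs β H).trace = 1 := by
  rw [gibbs, Matrix.trace_smul, smul_eq_mul, inv_mul_cancel₀ (trace_exp_ne_zero β hH)]

theorem norm_trace_gibbs_mul_le [NeZero D] (β : ℝ) {H : LocalAlgebra D Λ} (hH : H.IsHermitian)
    (M : LocalAlgebra D Λ) : ‖(gibbs β H * M).trace‖ ≤ ‖M‖ := by
  obtain ⟨hpos, hre⟩ := trace_exp_pos β hH
  have h := norm_trace_mul_le_of_posSemidef (posDef_exp_smul β hH).posSemidef M
  rw [gibbs, smul_mul_assoc, Matrix.trace_smul, smul_eq_mul, norm_mul, norm_inv, hre,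
    Complex.norm_real, Real.norm_of_nonneg hpos.le, inv_mul_le_iff₀ hpos]
  exact h

/-- The perturbed Gibbs state in terms of an intertwiner of the Gibbs weights. -/
theorem trace_gibbs_add_mul [NeZero D] {β : ℝ} (hβ : 0 < β) {H V ξ : LocalAlgebra D Λ}
    (hH : H.IsHermitian) (hV : V.IsHermitian)
    (hξ : NormedSpace.exp (-(β : ℂ) • (H + V)) = ξ * NormedSpace.exp (-(β : ℂ) • H) * star ξ) :
    Real.exp (-(β * ‖V‖)) ≤ ‖(ξ * gibbs β H * star ξ).trace‖ ∧
    ∀ B, (gibbs β (H + V) * B).trace =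
      (ξ * gibbs β H * star ξ).trace⁻¹ * (ξ * gibbs β H * star ξ * B).trace := by
  have h0 := trace_exp_ne_zero β hH
  have h1 := trace_exp_ne_zero β (hH.add hV)
  have hρ : ξ * gibbs β H * star ξ = (NormedSpace.exp (-(β : ℂ) • H)).trace⁻¹ •
      NormedSpace.exp (-(β : ℂ) • (H + V)) := by
    rw [gibbs, mul_smul_comm, smul_mul_assoc, hξ]
  rw [hρ]
  refine ⟨?_, fun B => ?_⟩
  · obtain ⟨hp0, hr0⟩ := trace_exp_pos β hH
    obtain ⟨hp1, hr1⟩ := trace_exp_pos β (hH.add hV)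
    rw [Matrix.trace_smul, smul_eq_mul, norm_mul, norm_inv, hr0, hr1, Complex.norm_real,
      Complex.norm_real, Real.norm_of_nonneg hp0.le, Real.norm_of_nonneg hp1.le,
      le_inv_mul_iff₀ hp0, mul_comm]
    exact exp_neg_mul_trace_le hβ hH hV
  · rw [gibbs, Matrix.trace_smul, smul_mul_assoc, smul_mul_assoc, Matrix.trace_smul,
      Matrix.trace_smul, smul_eq_mul, smul_eq_mul, smul_eq_mul]
    field_simp

/-- For the degenerate cases: if $X$ or $Y$ is empty the decay factor is 0, so the two expectations
have to agree exactly. -/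
theorem embed_empty (h : ∅ ⊆ Λ) (A : LocalAlgebra D ∅) :
    embed h A = A default default • (1 : LocalAlgebra D Λ) := by
  ext σ τ
  rw [embed_apply, Matrix.smul_apply, Matrix.one_apply, smul_eq_mul, mul_ite, mul_one, mul_zero]
  refine if_congr ⟨fun h => funext fun x => h x (Finset.notMem_empty _), fun h x _ => by rw [h]⟩
    ?_ rfl
  rw [Subsingleton.elim (restr h σ) default, Subsingleton.elim (restr h τ) default]

theorem gibbs_add_smul_one (β : ℝ) (H : LocalAlgebra D Λ) (z : ℂ) :
    gibbs β (H + z • (1 : LocalAlgebra D Λ)) = gibbs β H := by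
  have hexp : NormedSpace.exp (-(β : ℂ) • (H + z • (1 : LocalAlgebra D Λ))) =
      Complex.exp (-β * z) • NormedSpace.exp (-(β : ℂ) • H) := by
    have h1 : NormedSpace.exp (((-β : ℂ) * z) • (1 : LocalAlgebra D Λ)) =
        Complex.exp (-β * z) • (1 : LocalAlgebra D Λ) := by
      rw [← Algebra.algebraMap_eq_smul_one, ← Algebra.algebraMap_eq_smul_one,
        Complex.exp_eq_exp_ℂ, NormedSpace.algebraMap_exp_comm]
    rw [smul_add, smul_smul, Matrix.exp_add_of_commute _ _
      ((Commute.one_right _).smul_right _), h1, mul_smul_comm, mul_one]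
  rw [gibbs, gibbs, hexp, Matrix.trace_smul, smul_eq_mul, mul_inv, smul_smul, mul_right_comm,
    inv_mul_cancel₀ (Complex.exp_ne_zero _), one_mul]

end Gibbs

/-! ### Decay of correlations -/

section Correlations

theorem expDecay_nonneg (c : ℝ) (d : ℕ∞) : 0 ≤ expDecay c d := by
  rw [expDecay]
  split_ifs
  · rfl
  · positivity

theorem expDecay_le {c : ℝ} (hc : 0 ≤ c) {m : ℕ} {d : ℕ∞} (h : (m : ℕ∞) ≤ d) :
    expDecay c d ≤ Real.exp (-c * m) := by
  rw [expDecay]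
  split_ifs with hd
  · positivity
  · have h1 : m ≤ d.toNat := by
      rw [← ENat.natCast_toNat hd] at h
      exact_mod_cast h
    have h2 : (m : ℝ) ≤ d.toNat := by exact_mod_cast h1
    exact Real.exp_le_exp.2 (by nlinarith)

theorem le_setDist {X Y : Finset ℤ} {m : ℕ} (h : ∀ x ∈ X, ∀ y ∈ Y, m ≤ (x - y).natAbs) :
    (m : ℕ∞) ≤ setDist X Y :=
  le_iInf₂ fun x hx => le_iInf₂ fun y hy => by exact_mod_cast h x hx y hy

theorem setDist_le {X Y : Finset ℤ} {x y : ℤ} (hx : x ∈ X) (hy : y ∈ Y) :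
    setDist X Y ≤ ((x - y).natAbs : ℕ∞) :=
  (iInf₂_le x hx).trans (iInf₂_le y hy)

variable {D : ℕ} {I : Finset ℤ}

/-- By bilinearity of the covariance the assumption on observables of norm one extends to all
observables; zero observables cannot be normalized and are separate. -/
theorem norm_cov_embed_le {ρ : LocalAlgebra D I} {C c : ℝ} (hC : 0 ≤ C) (hc : 0 ≤ c)
    (hρ : DecayOfCorrelations ρ C c) {X Y : Finset ℤ} (hX : X ⊆ I) (hY : Y ⊆ I)
    (hXc : (X : Set ℤ).OrdConnected) (hYc : (Y : Set ℤ).OrdConnected) {m : ℕ}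
    (hm : (m : ℕ∞) ≤ setDist X Y) (A : LocalAlgebra D X) (B : LocalAlgebra D Y) :
    ‖cov ρ (embed hX A) (embed hY B)‖ ≤ C * Real.exp (-c * m) * (‖A‖ * ‖B‖) := by
  have hsmul : ∀ (a b : ℂ) (A : LocalAlgebra D X) (B : LocalAlgebra D Y),
      cov ρ (embed hX (a • A)) (embed hY (b • B)) =
        a * b * cov ρ (embed hX A) (embed hY B) := fun a b A B => by
    rw [← embedHom_apply hX, ← embedHom_apply hY, map_smul, map_smul, embedHom_apply,
      embedHom_apply]
    simp only [cov, mul_smul_comm, smul_mul_assoc, Matrix.trace_smul, smul_eq_mul]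
    ring
  by_cases hA : A = 0
  · have := hsmul 0 1 A B
    rw [zero_smul, one_smul, zero_mul, zero_mul, ← hA] at this
    rw [this, norm_zero]; positivity
  by_cases hB : B = 0
  · have := hsmul 1 0 A B
    rw [zero_smul, one_smul, mul_zero, zero_mul, ← hB] at this
    rw [this, norm_zero]; positivity
  have hA' : 0 < ‖A‖ := norm_pos_iff.2 hA
  have hB' : 0 < ‖B‖ := norm_pos_iff.2 hB
  set A₁ : LocalAlgebra D X := ((‖A‖⁻¹ : ℝ) : ℂ) • A with hA₁
  set B₁ : LocalAlgebra D Y := ((‖B‖⁻¹ : ℝ) : ℂ) • B with hB₁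
  have hA₁n : ‖A₁‖ = 1 := by
    rw [hA₁, norm_smul, Complex.norm_real, norm_inv, norm_norm, inv_mul_cancel₀ hA'.ne']
  have hB₁n : ‖B₁‖ = 1 := by
    rw [hB₁, norm_smul, Complex.norm_real, norm_inv, norm_norm, inv_mul_cancel₀ hB'.ne']
  have h1 : ENNReal.ofReal ‖cov ρ (embed hX A₁) (embed hY B₁)‖ ≤ eCov ρ hX hY :=
    (le_iSup₂ (f := fun (B : LocalAlgebra D Y) (_ : ‖B‖ = 1) =>
      ENNReal.ofReal ‖cov ρ (embed hX A₁) (embed hY B)‖) B₁ hB₁n).trans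
      (le_iSup₂ (f := fun (A : LocalAlgebra D X) (_ : ‖A‖ = 1) =>
        ⨆ (B : LocalAlgebra D Y) (_ : ‖B‖ = 1),
          ENNReal.ofReal ‖cov ρ (embed hX A) (embed hY B)‖) A₁ hA₁n)
  have h2 := (ENNReal.ofReal_le_ofReal_iff (mul_nonneg hC (expDecay_nonneg _ _))).1
    (h1.trans (hρ X Y hX hY hXc hYc))
  rw [hA₁, hB₁, hsmul, norm_mul, norm_mul, Complex.norm_real, Complex.norm_real, norm_inv, norm_inv,
    norm_norm, norm_norm, ← mul_inv, inv_mul_le_iff₀ (by positivity)] at h2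
  refine h2.trans ?_
  rw [mul_comm]
  gcongr
  exact expDecay_le hc hm

/-- Decay of correlations with a product observable on both sides of an interval. -/
theorem norm_cov_three_le {ρ A B₁ B₂ : LocalAlgebra D I} {κ : ℝ}
    (hρ : ∀ M, ‖(ρ * M).trace‖ ≤ ‖M‖) (hcomm : A * B₁ = B₁ * A) {a b₁ b₂ : ℝ}
    (ha : ‖A‖ ≤ a) (hb₁ : ‖B₁‖ ≤ b₁)
    (h1 : ‖cov ρ B₁ (A * B₂)‖ ≤ κ * (b₁ * (a * b₂))) (h2 : ‖cov ρ A B₂‖ ≤ κ * (a * b₂))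
    (h3 : ‖cov ρ B₁ B₂‖ ≤ κ * (b₁ * b₂)) :
    ‖(ρ * A * (B₁ * B₂)).trace - (ρ * A).trace * (ρ * (B₁ * B₂)).trace‖ ≤
      3 * κ * a * (b₁ * b₂) := by
  have e : (ρ * A * (B₁ * B₂)).trace - (ρ * A).trace * (ρ * (B₁ * B₂)).trace =
      cov ρ B₁ (A * B₂) + (ρ * B₁).trace * cov ρ A B₂ - (ρ * A).trace * cov ρ B₁ B₂ := by
    have e1 : ρ * A * (B₁ * B₂) = ρ * B₁ * (A * B₂) := by
      rw [mul_assoc ρ, ← mul_assoc A, hcomm, mul_assoc ρ, mul_assoc B₁]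
    rw [e1, cov, cov, cov, ← mul_assoc ρ A B₂, ← mul_assoc ρ B₁ B₂]
    ring
  rw [e]
  have g1 : ‖(ρ * B₁).trace * cov ρ A B₂‖ ≤ b₁ * (κ * (a * b₂)) := by
    rw [norm_mul]
    exact mul_le_mul ((hρ _).trans hb₁) h2 (norm_nonneg _) ((norm_nonneg _).trans hb₁)
  have g2 : ‖(ρ * A).trace * cov ρ B₁ B₂‖ ≤ a * (κ * (b₁ * b₂)) := by
    rw [norm_mul]
    exact mul_le_mul ((hρ _).trans ha) h3 (norm_nonneg _) ((norm_nonneg _).trans ha)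
  have g3 := norm_sub_le (cov ρ B₁ (A * B₂) + (ρ * B₁).trace * cov ρ A B₂)
    ((ρ * A).trace * cov ρ B₁ B₂)
  have g4 := norm_add_le (cov ρ B₁ (A * B₂)) ((ρ * B₁).trace * cov ρ A B₂)
  linarith

end Correlations

/-! ### Local indistinguishability -/

section Main

variable {D : ℕ} {I : Finset ℤ}

theorem ordConnected_filter {p : ℤ → Prop} [DecidablePred p] (hI : (I : Set ℤ).OrdConnected)
    (hp : {z | p z}.OrdConnected) : ((I.filter p : Finset ℤ) : Set ℤ).OrdConnected := by
  rw [Finset.coe_filter]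
  exact hI.inter hp

theorem localityConst_nonneg {b C β : ℝ} (hb : 0 < b) (hβ : 0 < β) :
    0 ≤ localityConst b C β := by
  have h1 : Real.exp (-b / 2) < 1 :=
    (Real.exp_lt_exp.2 (by linarith)).trans_eq Real.exp_zero
  refine div_nonneg (mul_nonneg (by positivity) ?_) (by linarith)
  exact MeasureTheory.integral_nonneg fun s => by positivity

/-- Local indistinguishability of the Gibbs states of `H_I` and `H_I + V`, for nonempty `X` at a
finite distance `d` from `Y₁ ∪ Y₂`. -/
theorem norm_trace_gibbs_sub_le [NeZero D] {Ψ : Interaction D} {b Cint β Ccov ccov : ℝ}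
    (hb : 0 < b) (hCint : 0 ≤ Cint) (hβ : 0 < β) (hCcov : 0 ≤ Ccov) (hccov : 0 ≤ ccov)
    (hΨ : Ψ.eNorm b ≤ ENNReal.ofReal Cint) (hI : (I : Set ℤ).OrdConnected)
    (hdecay : DecayOfCorrelations (gibbs β (Ψ.hamiltonian I)) Ccov ccov)
    {X Y₁ Y₂ : Finset ℤ} (hX : X ⊆ I) (hY₁ : Y₁ ⊆ I) (hY₂ : Y₂ ⊆ I)
    (hY₁c : (Y₁ : Set ℤ).OrdConnected) (hY₂c : (Y₂ : Set ℤ).OrdConnected)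
    {p q : ℤ} (hpq : p ≤ q) (hXpq : ∀ x ∈ X, p ≤ x ∧ x ≤ q) {d : ℕ} (hd : 0 < d)
    (hY₁d : ∀ y ∈ Y₁, y ≤ p - d) (hY₂d : ∀ y ∈ Y₂, q + d ≤ y)
    {V : LocalAlgebra D X} (hV : V.IsHermitian) (hV0 : V ≠ 0)
    (B₁ : LocalAlgebra D Y₁) (B₂ : LocalAlgebra D Y₂) :
    let B := embed hY₁ B₁ * embed hY₂ B₂
    ‖(gibbs β (Ψ.hamiltonian I) * B).trace - (gibbs β (Ψ.hamiltonian I + embed hX V) * B).trace‖ ≤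
      (3 * Ccov * Real.exp (-ccov * (d - d / 2 : ℕ)) +
        4 * localityConst b Cint β * Real.exp (-b / 2) ^ (d / 2)) *
          ‖B‖ * Real.exp (3 * β * ‖V‖) := by
  intro B
  -- The distance is shared: half for the locality of the intertwiner, the rest for the decay of
  -- correlations.
  set r := d / 2 with hr
  set m := d - r with hm
  have hrd : r < d := Nat.div_lt_self hd one_lt_two
  have hXw : ∀ n, X ⊆ window I p q n := fun n x hx =>
    mem_window.2 ⟨hX hx, by have := hXpq x hx; lia, by have := hXpq x hx; lia⟩
  set M := 2 / 3 * β * ‖V‖ with hM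
  set H := Ψ.hamiltonian I with hH
  have hHh : H.IsHermitian := Ψ.isHermitian_hamiltonian I
  have hVh : (embed hX V).IsHermitian := isHermitian_embed _ hV
  set L := localityConst b Cint β * Real.exp (-b / 2) ^ r with hL
  have hL0 : 0 ≤ L := mul_nonneg (localityConst_nonneg hb hβ) (by positivity)
  obtain ⟨ξ, ζ', hξ, hξn, hζn, hdiff⟩ := exists_local_intertwiner hb hCint hβ hΨ hXw hV hV0 r
  obtain ⟨hw, hgibbs⟩ := trace_gibbs_add_mul hβ hHh hVh hξ
  set ζ := embed (window_subset I p q r) ζ' with hζ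
  have hw₁ : Disjoint (window I p q r) Y₁ := Finset.disjoint_left.2 fun z hz hy => by
    have := mem_window.1 hz
    have := hY₁d z hy
    lia
  have hw₂ : Disjoint (window I p q r) Y₂ := Finset.disjoint_left.2 fun z hz hy => by
    have := mem_window.1 hz
    have := hY₂d z hy
    lia
  have hBζ : B * ζ = ζ * B := by
    rw [mul_assoc, ← embed_mul_embed_comm _ _ hw₂, ← mul_assoc, ← embed_mul_embed_comm _ _ hw₁,
      mul_assoc]
  set A' := star ζ' * ζ' with hA'
  have hA'n : ‖A'‖ ≤ Real.exp (2 * M) := by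
    rw [hA', CStarRing.norm_star_mul_self, two_mul, Real.exp_add]
    gcongr
  have hA : star ζ * ζ = embed (window_subset I p q r) A' := by
    rw [hA', embed_mul, hζ]
    congr 1
    exact (embed_conjTranspose _ _).symm
  -- The supports of $\zeta^*\zeta$ and $B_2$ are merged into one interval $J$, since decay is
  -- assumed only between intervals; $J$ fills the gap without coming nearer to $Y_1$ than the
  -- window.
  set J := I.filter fun z => p - r ≤ z with hJ
  have hJI : J ⊆ I := Finset.filter_subset _ _
  have hwJ : window I p q r ⊆ J := fun z hz => by
    have := mem_window.1 hz
    exact Finset.mem_filter.2 ⟨this.1, this.2.1⟩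
  have hY₂J : Y₂ ⊆ J := fun z hz => by
    have := hY₂d z hz
    exact Finset.mem_filter.2 ⟨hY₂ hz, by lia⟩
  have hJc : (J : Set ℤ).OrdConnected := ordConnected_filter hI Set.ordConnected_Ici
  have hwc : ((window I p q r : Finset ℤ) : Set ℤ).OrdConnected :=
    ordConnected_filter hI Set.ordConnected_Icc
  have hd₁ : (m : ℕ∞) ≤ setDist Y₁ J := le_setDist fun y hy z hz => by
    have := hY₁d y hy
    have := (Finset.mem_filter.1 hz).2
    lia
  have hd₂ : (m : ℕ∞) ≤ setDist (window I p q r) Y₂ := le_setDist fun z hz y hy => by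
    have := mem_window.1 hz
    have := hY₂d y hy
    lia
  have hd₃ : (m : ℕ∞) ≤ setDist Y₁ Y₂ := le_setDist fun y hy z hz => by
    have := hY₁d y hy
    have := hY₂d z hz
    lia
  have hρ := norm_trace_gibbs_mul_le β hHh
  set κ := Ccov * Real.exp (-ccov * m) with hκ
  have hκ0 : 0 ≤ κ := by positivity
  have hcov : ‖(gibbs β H * (star ζ * ζ) * B).trace -
      (gibbs β H * (star ζ * ζ)).trace * (gibbs β H * B).trace‖ ≤
        3 * κ * Real.exp (2 * M) * (‖B₁‖ * ‖B₂‖) := by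
    rw [hA]
    refine norm_cov_three_le hρ (embed_mul_embed_comm _ _ hw₁ _ _) ((norm_embed _ _).trans_le hA'n)
      (norm_embed _ _).le ?_ ?_ ?_
    · have e : embed (window_subset I p q r) A' * embed hY₂ B₂ =
          embed hJI (embed hwJ A' * embed hY₂J B₂) := by
        rw [embed_mul hJI, embed_embed, embed_embed]
      rw [e]
      refine (norm_cov_embed_le hCcov hccov hdecay hY₁ hJI hY₁c hJc hd₁ _ _).trans ?_
      gcongr
      refine (norm_mul_le _ _).trans ?_
      rw [norm_embed, norm_embed]
      gcongr
    · refine (norm_cov_embed_le hCcov hccov hdecay _ hY₂ hwc hY₂c hd₂ _ _).trans ?_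
      gcongr
    · exact norm_cov_embed_le hCcov hccov hdecay hY₁ hY₂ hY₁c hY₂c hd₃ _ _
  have hY₁₂ : Disjoint Y₁ Y₂ := Finset.disjoint_left.2 fun z hz hy => by
    have := hY₁d z hz
    have := hY₂d z hy
    lia
  have hBn : ‖B₁‖ * ‖B₂‖ ≤ ‖B‖ := norm_mul_norm_le_norm_embed_mul_embed hY₁ hY₂ hY₁₂ B₁ B₂
  rw [norm_embed] at hw
  have key := norm_trace_sub_perturbed_le hρ hξn ((norm_embed _ _).trans_le hζn) hdiff hBζ hcov hw
  rw [hgibbs]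
  refine key.trans ?_
  have hexp1 : Real.exp (2 * M) ≤ Real.exp (2 * β * ‖V‖) := by
    refine Real.exp_le_exp.2 ?_
    have : 0 ≤ β * ‖V‖ := by positivity
    rw [hM]; linarith
  have hexp2 : Real.exp M * Real.exp (2 * M) = Real.exp (2 * β * ‖V‖) := by
    rw [← Real.exp_add, hM]; congr 1; ring
  have hexp3 : Real.exp (β * ‖V‖) * Real.exp (2 * β * ‖V‖) = Real.exp (3 * β * ‖V‖) := by
    rw [← Real.exp_add]; congr 1; ring
  have h1 : 3 * κ * Real.exp (2 * M) * (‖B₁‖ * ‖B₂‖) ≤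
      3 * κ * Real.exp (2 * β * ‖V‖) * ‖B‖ := by gcongr
  calc Real.exp (β * ‖V‖) * (3 * κ * Real.exp (2 * M) * (‖B₁‖ * ‖B₂‖) +
        4 * Real.exp M * (L * Real.exp (2 * M)) * ‖B‖)
      ≤ Real.exp (β * ‖V‖) * (3 * κ * Real.exp (2 * β * ‖V‖) * ‖B‖ +
        4 * Real.exp M * (L * Real.exp (2 * M)) * ‖B‖) := by gcongr
    _ = (3 * κ + 4 * L) * ‖B‖ * (Real.exp (β * ‖V‖) * Real.exp (2 * β * ‖V‖)) := by
        rw [← hexp2]; ring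
    _ = _ := by rw [hexp3, hκ, hL]; ring

end Main

/-- The bound without the factor `1 + ‖V‖`, for all perturbations. -/
theorem norm_trace_gibbs_sub_le_expDecay {D : ℕ} [NeZero D] {I : Finset ℤ} {Ψ : Interaction D}
    {b Cint β Ccov ccov : ℝ} (hb : 0 < b) (hCint : 0 ≤ Cint) (hβ : 0 < β) (hCcov : 0 ≤ Ccov)
    (hccov : 0 ≤ ccov) (hΨ : Ψ.eNorm b ≤ ENNReal.ofReal Cint) (hI : (I : Set ℤ).OrdConnected)
    (hdecay : DecayOfCorrelations (gibbs β (Ψ.hamiltonian I)) Ccov ccov)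
    {X Y₁ Y₂ : Finset ℤ} (hX : X ⊆ I) (hY₁ : Y₁ ⊆ I) (hY₂ : Y₂ ⊆ I)
    (hY₁c : (Y₁ : Set ℤ).OrdConnected) (hY₂c : (Y₂ : Set ℤ).OrdConnected)
    (hY₁X : ∀ y ∈ Y₁, ∀ x ∈ X, y < x) (hXY₂ : ∀ x ∈ X, ∀ y ∈ Y₂, x < y)
    {V : LocalAlgebra D X} (hV : V.IsHermitian)
    (B₁ : LocalAlgebra D Y₁) (B₂ : LocalAlgebra D Y₂) :
    let B := embed hY₁ B₁ * embed hY₂ B₂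
    ‖(gibbs β (Ψ.hamiltonian I) * B).trace - (gibbs β (Ψ.hamiltonian I + embed hX V) * B).trace‖ ≤
      (3 * Ccov + 4 * localityConst b Cint β * Real.exp (b / 4)) * ‖B‖ * Real.exp (3 * β * ‖V‖) *
        expDecay (min (ccov / 2) (b / 4)) (setDist X (Y₁ ∪ Y₂)) := by
  intro B
  have hL := localityConst_nonneg (C := Cint) hb hβ
  have hrhs : 0 ≤ (3 * Ccov + 4 * localityConst b Cint β * Real.exp (b / 4)) * ‖B‖ *
      Real.exp (3 * β * ‖V‖) * expDecay (min (ccov / 2) (b / 4)) (setDist X (Y₁ ∪ Y₂)) :=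
    mul_nonneg (by positivity) (expDecay_nonneg _ _)
  have hH := Ψ.isHermitian_hamiltonian I
  have hHV := hH.add (isHermitian_embed hX hV)
  have hzero : (gibbs β (Ψ.hamiltonian I) * B).trace =
      (gibbs β (Ψ.hamiltonian I + embed hX V) * B).trace → ‖(gibbs β (Ψ.hamiltonian I) * B).trace -
        (gibbs β (Ψ.hamiltonian I + embed hX V) * B).trace‖ ≤
      (3 * Ccov + 4 * localityConst b Cint β * Real.exp (b / 4)) * ‖B‖ *
      Real.exp (3 * β * ‖V‖) * expDecay (min (ccov / 2) (b / 4)) (setDist X (Y₁ ∪ Y₂)) := fun h => by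
    rwa [h, sub_self, norm_zero]
  rcases X.eq_empty_or_nonempty with rfl | hXne
  · refine hzero ?_
    rw [embed_empty, gibbs_add_smul_one]
  rcases (Y₁ ∪ Y₂).eq_empty_or_nonempty with hY | hYne
  · obtain ⟨rfl, rfl⟩ := Finset.union_eq_empty.1 hY
    refine hzero ?_
    simp only [B, embed_empty, mul_smul_comm, mul_one, Matrix.trace_smul, trace_gibbs β hH,
      trace_gibbs β hHV]
  by_cases hV0 : V = 0
  · refine hzero ?_
    rw [hV0, ← embedHom_apply, map_zero, add_zero]
  obtain ⟨x₀, hx₀⟩ := hXne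
  obtain ⟨y₀, hy₀⟩ := hYne
  have htop : setDist X (Y₁ ∪ Y₂) ≠ ⊤ :=
    ((setDist_le hx₀ hy₀).trans_lt (ENat.natCast_lt_top _)).ne
  set d := (setDist X (Y₁ ∪ Y₂)).toNat with hd
  have hdist : ∀ x ∈ X, ∀ y ∈ Y₁ ∪ Y₂, d ≤ (x - y).natAbs := fun x hx y hy => by
    have h := setDist_le hx hy
    rw [← ENat.natCast_toNat htop] at h
    exact_mod_cast h
  have hne : ∀ x ∈ X, ∀ y ∈ Y₁ ∪ Y₂, 1 ≤ (x - y).natAbs := fun x hx y hy => by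
    rcases Finset.mem_union.1 hy with h | h
    · have := hY₁X y h x hx; lia
    · have := hXY₂ x hx y h; lia
  have hd1 : 0 < d := by
    have h := le_setDist hne
    rw [← ENat.natCast_toNat htop] at h
    have h' : 1 ≤ d := by exact_mod_cast h
    lia
  have hXne : X.Nonempty := ⟨x₀, hx₀⟩
  have hmin := X.min'_mem hXne
  have hmax := X.max'_mem hXne
  have key := norm_trace_gibbs_sub_le hb hCint hβ hCcov hccov hΨ hI hdecay hX hY₁ hY₂ hY₁c hY₂c
    (p := X.min' hXne) (q := X.max' hXne) (X.min'_le _ hmax)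
    (fun x hx => ⟨X.min'_le x hx, X.le_max' x hx⟩) hd1
    (fun y hy => by
      have h1 := hdist _ hmin y (Finset.mem_union_left _ hy)
      have h2 := hY₁X y hy _ hmin
      lia)
    (fun y hy => by
      have h1 := hdist _ hmax y (Finset.mem_union_right _ hy)
      have h2 := hXY₂ _ hmax y hy
      lia) hV hV0 B₁ B₂
  refine key.trans ?_
  rw [expDecay, if_neg htop, ← hd]
  set c := min (ccov / 2) (b / 4) with hc
  have hc1 : c ≤ ccov / 2 := min_le_left _ _
  have hc2 : c ≤ b / 4 := min_le_right _ _
  have e1 : Real.exp (-ccov * (d - d / 2 : ℕ)) ≤ Real.exp (-c * d) := by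
    refine Real.exp_le_exp.2 ?_
    have h1 : (d : ℝ) ≤ 2 * (d - d / 2 : ℕ) := by
      have : d ≤ 2 * (d - d / 2) := by lia
      exact_mod_cast this
    nlinarith [Nat.cast_nonneg (α := ℝ) d]
  -- The factor $e^{b/4}$ pays for rounding $d/2$ down.
  have e2 : Real.exp (-b / 2) ^ (d / 2) ≤ Real.exp (b / 4) * Real.exp (-c * d) := by
    rw [← Real.exp_nat_mul, ← Real.exp_add]
    refine Real.exp_le_exp.2 ?_
    have h1 : (d : ℝ) ≤ 2 * (d / 2 : ℕ) + 1 := by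
      have : d ≤ 2 * (d / 2) + 1 := by lia
      exact_mod_cast this
    nlinarith [Nat.cast_nonneg (α := ℝ) d]
  calc _ ≤ (3 * Ccov * Real.exp (-c * d) + 4 * localityConst b Cint β *
        (Real.exp (b / 4) * Real.exp (-c * d))) * ‖B‖ * Real.exp (3 * β * ‖V‖) := by gcongr
    _ = _ := by ring

end SpinChain

theorem mainTheorem6 (b Cint β Ccov ccov : ℝ) (hb : 0 < b) (hCint : 0 < Cint) (hβ : 0 < β)
    (hCcov : 0 < Ccov) (hccov : 0 < ccov) :
    ∃ C c : ℝ, 0 < C ∧ 0 < c ∧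
      ∀ (D : ℕ) (_ : 0 < D) (Ψ : SpinChain.Interaction D) (I : Finset ℤ),
        Ψ.eNorm b ≤ ENNReal.ofReal Cint →
        (I : Set ℤ).OrdConnected →
        SpinChain.DecayOfCorrelations (SpinChain.gibbs β (Ψ.hamiltonian I)) Ccov ccov →
        ∀ (X Y₁ Y₂ : Finset ℤ) (hX : X ⊆ I) (hY₁ : Y₁ ⊆ I) (hY₂ : Y₂ ⊆ I),
          (X : Set ℤ).OrdConnected → (Y₁ : Set ℤ).OrdConnected → (Y₂ : Set ℤ).OrdConnected →
          (∀ y ∈ Y₁, ∀ x ∈ X, y < x) → (∀ x ∈ X, ∀ y ∈ Y₂, x < y) →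
          (∀ y ∈ Y₁, ∀ y' ∈ Y₂, y < y') →
          ∀ (V : SpinChain.LocalAlgebra D X), V.IsHermitian →
          ∀ (B₁ : SpinChain.LocalAlgebra D Y₁) (B₂ : SpinChain.LocalAlgebra D Y₂)
            (B : SpinChain.LocalAlgebra D I),
            B = SpinChain.embed hY₁ B₁ * SpinChain.embed hY₂ B₂ →
            ‖(SpinChain.gibbs β (Ψ.hamiltonian I) * B).trace
                - (SpinChain.gibbs β (Ψ.hamiltonian I + SpinChain.embed hX V) * B).trace‖
              ≤ C * ‖B‖ * Real.exp (3 * β * ‖V‖) * (1 + ‖V‖)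
                  * SpinChain.expDecay c (SpinChain.setDist X (Y₁ ∪ Y₂)) ∧
            -- the factor `1 + ‖V‖` can be dropped if `V`, written as an interaction `Φ`,
            -- satisfies `‖Ψ + Φ‖_b ≤ Cint`
            ∀ (Φ : SpinChain.Interaction D), Φ.hamiltonian I = SpinChain.embed hX V →
              (Ψ + Φ).eNorm b ≤ ENNReal.ofReal Cint →
              ‖(SpinChain.gibbs β (Ψ.hamiltonian I) * B).trace
                  - (SpinChain.gibbs β (Ψ.hamiltonian I + SpinChain.embed hX V) * B).trace‖
                ≤ C * ‖B‖ * Real.exp (3 * β * ‖V‖)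
                    * SpinChain.expDecay c (SpinChain.setDist X (Y₁ ∪ Y₂)) := by
  have hL := SpinChain.localityConst_nonneg (C := Cint) hb hβ
  refine ⟨3 * Ccov + 4 * SpinChain.localityConst b Cint β * Real.exp (b / 4),
    min (ccov / 2) (b / 4), by positivity, by positivity, ?_⟩
  intro D hD Ψ I hΨ hI hdecay X Y₁ Y₂ hX hY₁ hY₂ _ hY₁c hY₂c hY₁X hXY₂ _ V hV B₁ B₂ B hB
  subst hB
  have : NeZero D := ⟨hD.ne'⟩
  have key := SpinChain.norm_trace_gibbs_sub_le_expDecay hb hCint.le hβ hCcov.le hccov.le hΨ hI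
    hdecay hX hY₁ hY₂ hY₁c hY₂c hY₁X hXY₂ hV B₁ B₂
  refine ⟨key.trans ?_, fun _ _ _ => key⟩
  refine mul_le_mul_of_nonneg_right ?_ (SpinChain.expDecay_nonneg _ _)
  exact le_mul_of_one_le_right (by positivity) (by linarith [norm_nonneg V])
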